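/- Identify $\mathbb{C}^2$ with $\mathbb{R}^4$ and let $\mathcal{M}=\{(z,w)\in\mathbb{C}^2 : w^2 = 2\,\mathrm{Re}\,z\; e^{-2i\,\mathrm{Im}\,z},\ \mathrm{Re}\,z\ge 0\}$. A smooth immersion $\phi:M\to\mathbb{C}^2$ of a surface is a translating soliton for mean curvature flow if its mean curvature vector $H$ (the trace of the second fundamental form) satisfies $H=\mathbf{e}^\perp$, the normal part of $\mathbf{e}$, for some nonzero constant vector $\mathbf{e}\in\mathbb{C}^2$. It is Lagrangian if the Kähler form of $\mathbb{C}^2$ vanishes on it. A Lagrangian immersion is Hamiltonian stationary if its (local) Lagrangian angle $\beta$, given by $\phi^*(dz\wedge dw)=e^{i\beta}\,dA$, is harmonic for the Laplace operator of the induced metric. Let $M$ be a connected smooth surface (without boundary), and let $\phi:M\to\mathbb{C}^2$ be a Hamiltonian stationary Lagrangian translating soliton for mean curvature flow that is not totally geodesic (its second fundamental form does not vanish identically). Then, up to dilations and complex-linear congruences, $\phi(M)$ is an open subset of $\mathcal{M}$: there are $r>0$, a unitary transformation $U$ of $\mathbb{C}^2$ and $v\in\mathbb{C}^2$ such that $\phi(M)$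 is a relatively open subset of $\{rU(p)+v : p\in\mathcal{M}\}$. Moreover, $\mathcal{M}$ is itself such an example: it is the image of an injective immersion $\Phi:\mathbb{R}^2\to\mathbb{C}^2$, a homeomorphism onto its image, which is a Hamiltonian stationary Lagrangian translating soliton with translating vector $(1,0)$ and is not totally geodesic. Hence, up to these similarities and passing to open subsets, $\mathcal{M}$ is the only example that is not totally geodesic. -/

import Mathlib

open scoped Manifold ContDiff

noncomputable section

namespace LagrangianSoliton

/-- The parameter plane `ℝ²`, on which surfaces are modelled. -/
abbrev R2 : Type := EuclideanSpace ℝ (Fin 2)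

/-- The complex Euclidean plane `ℂ²`. Its Euclidean metric is the real inner product
`inner ℝ v w = Re ∑ i, v i * conj (w i)`, its complex structure is multiplication by `I`. -/
abbrev C2 : Type := EuclideanSpace ℂ (Fin 2)

/-- The Kähler form `ω(v, w) = ⟨J v, w⟩` of `ℂ²`. -/
def kaehler (v w : C2) : ℝ := inner ℝ (Complex.I • v) w

/-! ### Local geometry of a parametrized surface `f : ℝ² → ℂ²` -/

/-- The partial derivative `∂ᵢ f`. -/
def pderiv {E : Type*} [NormedAddCommGroup E] [NormedSpace ℝ E]
    (i : Fin 2) (f : R2 → E) (x : R2) : E :=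
  fderiv ℝ f x (EuclideanSpace.single i 1)

/-- The induced metric `gᵢⱼ = ⟨∂ᵢ f, ∂ⱼ f⟩`. -/
def metric (f : R2 → C2) (x : R2) : Matrix (Fin 2) (Fin 2) ℝ :=
  Matrix.of fun i j => inner ℝ (pderiv i f x) (pderiv j f x)

/-- The area density `√(det g)`. -/
def areaDensity (f : R2 → C2) (x : R2) : ℝ := √((metric f x).det)

/-- The component of `v` normal to the surface at `f x`. -/
def normalPart (f : R2 → C2) (x : R2) (v : C2) : C2 :=
  (LinearMap.range (fderiv ℝ f x).toLinearMap)ᗮ.starProjection v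

/-- The second fundamental form `σ(∂ᵢ, ∂ⱼ) = (∂ᵢ ∂ⱼ f)^⊥`. -/
def secondFundamentalForm (f : R2 → C2) (x : R2) (i j : Fin 2) : C2 :=
  normalPart f x (pderiv i (pderiv j f) x)

/-- The mean curvature vector `H = trace σ = ∑ gⁱʲ σ(∂ᵢ, ∂ⱼ)`. -/
def meanCurvature (f : R2 → C2) (x : R2) : C2 :=
  ∑ i, ∑ j, (metric f x)⁻¹ i j • secondFundamentalForm f x i j

/-- The Laplace operator of the induced metric,
`Δ u = (det g)^(-1/2) ∑ ∂ᵢ ((det g)^(1/2) gⁱʲ ∂ⱼ u)`. -/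
def laplaceBeltrami (f : R2 → C2) (u : R2 → ℝ) (x : R2) : ℝ :=
  (areaDensity f x)⁻¹ * ∑ i,
    pderiv i (fun y => areaDensity f y * ∑ j, (metric f y)⁻¹ i j * pderiv j u y) x

/-- The value `(dz₁ ∧ dz₂)(∂₁ f, ∂₂ f)`. -/
def complexDet (f : R2 → C2) (x : R2) : ℂ :=
  pderiv 0 f x 0 * pderiv 1 f x 1 - pderiv 0 f x 1 * pderiv 1 f x 0

/-- `β` is a (smooth, real-valued) Lagrangian angle of `f` on `V`, that is
`f^*(dz₁ ∧ dz₂) = e^{iβ} dA` on `V`, for the orientation given by the parameters. -/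
def IsLagrangianAngleOn (f : R2 → C2) (V : Set R2) (β : R2 → ℝ) : Prop :=
  ContDiffOn ℝ ∞ β V ∧
    ∀ x ∈ V, complexDet f x = Complex.exp (Complex.I * (β x : ℂ)) * (areaDensity f x : ℂ)

/-! ### Immersed surfaces in `ℂ²` -/

section Surfaces

variable {M : Type*} [TopologicalSpace M] [ChartedSpace R2 M]

/-- A smooth immersion of a surface into `ℂ²`. -/
def IsSmoothImmersion (φ : M → C2) : Prop :=
  ContMDiff (𝓡 2) 𝓘(ℝ, C2) ∞ φ ∧
    ∀ p : M, Function.Injective (mfderiv (𝓡 2) 𝓘(ℝ, C2) φ p)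

/-- `φ^* ω = 0`, in every chart of the surface. -/
def IsLagrangian (φ : M → C2) : Prop :=
  ∀ c ∈ atlas R2 M, ∀ x ∈ c.target, ∀ i j : Fin 2,
    kaehler (pderiv i (φ ∘ c.symm) x) (pderiv j (φ ∘ c.symm) x) = 0

/-- The second fundamental form vanishes identically. -/
def IsTotallyGeodesic (φ : M → C2) : Prop :=
  ∀ c ∈ atlas R2 M, ∀ x ∈ c.target, ∀ i j : Fin 2,
    secondFundamentalForm (φ ∘ c.symm) x i j = 0

/-- The immersion `φ` is a translating soliton for mean curvature flow with translating
vector `e`: the vector `e` is nonzero and `H = e^⊥`. -/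
def IsTranslatingSoliton (φ : M → C2) (e : C2) : Prop :=
  e ≠ 0 ∧ ∀ c ∈ atlas R2 M, ∀ x ∈ c.target,
    meanCurvature (φ ∘ c.symm) x = normalPart (φ ∘ c.symm) x e

/-- The Lagrangian angle of `φ`, which is in general only locally a single-valued function,
and which depends on a local orientation up to the addition of a constant, is harmonic for the
Laplace operator of the induced metric. -/
def IsHamiltonianStationary (φ : M → C2) : Prop :=
  ∀ c ∈ atlas R2 M, ∀ x ∈ c.target, ∃ V : Set R2, IsOpen V ∧ x ∈ V ∧ V ⊆ c.target ∧
    ∃ β : R2 → ℝ, IsLagrangianAngleOn (φ ∘ c.symm) V β ∧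
      ∀ y ∈ V, laplaceBeltrami (φ ∘ c.symm) β y = 0

/-- A Hamiltonian stationary Lagrangian translating soliton for mean curvature flow in `ℂ²`,
with translating vector `e`. -/
structure IsHSLTranslatingSoliton (φ : M → C2) (e : C2) : Prop where
  immersion : IsSmoothImmersion φ
  lagrangian : IsLagrangian φ
  hamiltonianStationary : IsHamiltonianStationary φ
  translating : IsTranslatingSoliton φ e

end Surfaces

/-- The surface `{(z, w) : w² = 2 Re z · e^{-2i Im z}, Re z ≥ 0}` in `ℂ²`. -/
def surfaceM : Set C2 :=
  {p | p 1 ^ 2 = 2 * ((p 0).re : ℂ) * Complex.exp (-2 * Complex.I * ((p 0).im : ℂ)) ∧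
    0 ≤ (p 0).re}

end LagrangianSoliton

end

namespace LagrangianSoliton

/-! ### Partial derivatives -/

section PartialDerivatives

variable {E : Type*} [NormedAddCommGroup E] [NormedSpace ℝ E]

/-! Let f be a local parametrization, u = ⟨e, f⟩ and v = ⟨Je, f⟩ = `kaehler e f`, and let * be the
Hodge star of the induced metric. Then `conjDiff` is *df, and d*df = H dA
(`laplacian_eq_meanCurvature`). On a Lagrangian surface dβ = ω(df, H) (`pderiv_angle`), so H = e^⊥
forces dβ = -dv, and Hamiltonian stationarity becomes harmonicity of v (`laplacian_im`). Pairing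
d*df = e^⊥ dA with Je then gives ⟨Je, e^⊥⟩ = 0, which says that the gradients of u and v are
orthogonal (`conj_parallel`).

Where e is not tangent, dv ≠ 0, so du = s *dv for a function s = `conjHeight`, and *du = -s dv.
Differentiating both relations yields ds = *dv (`pderiv_conjHeight`). Hence (s, v) are conformal
coordinates, u - s²/2 is constant, and, as β + v is constant, d det(e, f) = K d(s e^{-iv}) with |K|
= 1. In the coordinates `heightMap e`, a multiple of a unitary map, the surface is therefore locally
a `model`.

To globalize, two facts are needed. First, N = |e^⊥|² equals |e|²/(1 + s²) where it is nonzero,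
which gives |dN| ≤ |*dv| N componentwise; by Grönwall its zero set is open as well as closed. If it
is everything, e is a parallel tangent field and H = 0, which kills the cubic form of the surface
(`secondFundamentalForm_eq_zero`); so if the surface is not totally geodesic, e is nowhere tangent.
Second, two models sharing an open piece have the same image (`range_model_eq_of_eventually`), so by
connectedness a single model contains the whole image.

Conversely `model 1 0 0` parametrizes `surfaceM`; its metric is (1 + s²)(ds² + dv²), and the
required properties are checked by differentiation. -/

lemma pderiv_congr {f g : R2 → E} {x : R2} (h : f =ᶠ[nhds x] g) (i : Fin 2) :
    pderiv i f x = pderiv i g x := by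
  simp only [pderiv, h.fderiv_eq]

lemma contDiffAt_pderiv {f : R2 → E} {x : R2} (hf : ContDiffAt ℝ ∞ f x) (i : Fin 2) :
    ContDiffAt ℝ ∞ (pderiv i f) x :=
  (hf.fderiv_right (m := ∞) le_rfl).clm_apply contDiffAt_const

lemma ContDiffAt.diff {f : R2 → E} {x : R2} (hf : ContDiffAt ℝ ∞ f x) : DifferentiableAt ℝ f x :=
  hf.differentiableAt (by simp)

lemma pderiv_comm {f : R2 → E} {x : R2} (hf : ContDiffAt ℝ ∞ f x) (i j : Fin 2) :
    pderiv i (pderiv j f) x = pderiv j (pderiv i f) x := by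
  have hd : DifferentiableAt ℝ (fderiv ℝ f) x :=
    (hf.fderiv_right (m := ∞) le_rfl).differentiableAt (by simp)
  have key : ∀ k l : Fin 2, pderiv k (pderiv l f) x =
      fderiv ℝ (fderiv ℝ f) x (EuclideanSpace.single k 1) (EuclideanSpace.single l 1) := by
    intro k l
    have : HasFDerivAt (pderiv l f) _ x :=
      hd.hasFDerivAt.clm_apply (hasFDerivAt_const (EuclideanSpace.single l (1 : ℝ)) x)
    rw [pderiv, this.fderiv]
    simp
  rw [key, key]
  refine hf.isSymmSndFDerivAt ?_ _ _
  rw [minSmoothness_of_isRCLikeNormedField]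
  exact WithTop.coe_le_coe.2 (le_top : (2 : ℕ∞) ≤ ⊤)

lemma pderiv_add {f g : R2 → E} {x : R2} (hf : DifferentiableAt ℝ f x)
    (hg : DifferentiableAt ℝ g x) (i : Fin 2) :
    pderiv i (fun y => f y + g y) x = pderiv i f x + pderiv i g x := by
  simp [pderiv, fderiv_fun_add hf hg]

lemma pderiv_sub {f g : R2 → E} {x : R2} (hf : DifferentiableAt ℝ f x)
    (hg : DifferentiableAt ℝ g x) (i : Fin 2) :
    pderiv i (fun y => f y - g y) x = pderiv i f x - pderiv i g x := by
  simp [pderiv, fderiv_fun_sub hf hg]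

lemma pderiv_neg (f : R2 → E) (x : R2) (i : Fin 2) :
    pderiv i (fun y => - f y) x = - pderiv i f x := by
  simp [pderiv]

lemma pderiv_smul {f : R2 → E} {c : R2 → ℝ} {x : R2} (hc : DifferentiableAt ℝ c x)
    (hf : DifferentiableAt ℝ f x) (i : Fin 2) :
    pderiv i (fun y => c y • f y) x = c x • pderiv i f x + pderiv i c x • f x := by
  simp [pderiv, fderiv_fun_smul hc hf]

lemma pderiv_const (c : E) (x : R2) (i : Fin 2) : pderiv i (fun _ => c) x = 0 := by
  simp [pderiv]

lemma pderiv_mul {𝔸 : Type*} [NormedCommRing 𝔸] [NormedAlgebra ℝ 𝔸] {f g : R2 → 𝔸} {x : R2}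
    (hf : DifferentiableAt ℝ f x) (hg : DifferentiableAt ℝ g x) (i : Fin 2) :
    pderiv i (fun y => f y * g y) x = f x * pderiv i g x + g x * pderiv i f x := by
  simp [pderiv, fderiv_fun_mul hf hg]

lemma pderiv_comp {g : ℝ → E} {g' : E} {f : R2 → ℝ} {x : R2} (hg : HasDerivAt g g' (f x))
    (hf : DifferentiableAt ℝ f x) (i : Fin 2) :
    pderiv i (fun y => g (f y)) x = pderiv i f x • g' := by
  have : HasFDerivAt (fun y => g (f y)) _ x := hg.hasFDerivAt.comp x hf.hasFDerivAt
  simp [pderiv, this.fderiv]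

lemma pderiv_clm {E' : Type*} [NormedAddCommGroup E'] [NormedSpace ℝ E'] (L : E →L[ℝ] E')
    {f : R2 → E} {x : R2} (hf : DifferentiableAt ℝ f x) (i : Fin 2) :
    pderiv i (fun y => L (f y)) x = L (pderiv i f x) := by
  have : HasFDerivAt (fun y => L (f y)) _ x := L.hasFDerivAt.comp x hf.hasFDerivAt
  simp [pderiv, this.fderiv]

lemma pderiv_inner {f g : R2 → C2} {x : R2} (hf : DifferentiableAt ℝ f x)
    (hg : DifferentiableAt ℝ g x) (i : Fin 2) :
    pderiv i (fun y => (inner ℝ (f y) (g y) : ℝ)) x =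
      inner ℝ (pderiv i f x) (g x) + inner ℝ (f x) (pderiv i g x) := by
  simp only [pderiv]
  rw [fderiv_inner_apply ℝ hf hg, add_comm]

lemma pderiv_const_inner (c : C2) {g : R2 → C2} {x : R2} (hg : DifferentiableAt ℝ g x)
    (i : Fin 2) :
    pderiv i (fun y => (inner ℝ c (g y) : ℝ)) x = inner ℝ c (pderiv i g x) :=
  pderiv_clm (innerSL ℝ c) hg i

lemma fderiv_eq_pderiv (f : R2 → E) (x h : R2) :
    fderiv ℝ f x h = h 0 • pderiv 0 f x + h 1 • pderiv 1 f x := by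
  have : h = h 0 • EuclideanSpace.single (0 : Fin 2) (1 : ℝ) +
      h 1 • EuclideanSpace.single (1 : Fin 2) (1 : ℝ) := by
    ext i; fin_cases i <;> simp
  conv_lhs => rw [this]
  simp [pderiv]

lemma fderiv_eq_zero_of_pderiv {f : R2 → E} {x : R2} (h : ∀ i, pderiv i f x = 0) :
    fderiv ℝ f x = 0 := by
  ext y
  simp [fderiv_eq_pderiv, h]

/-- A function with vanishing partial derivatives near a point is constant near that point. -/
lemma eventually_eq_of_pderiv_eq_zero {f : R2 → E} {x : R2}
    (hf : ∀ᶠ y in nhds x, DifferentiableAt ℝ f y)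
    (h : ∀ᶠ y in nhds x, ∀ i, pderiv i f y = 0) : ∀ᶠ y in nhds x, f y = f x := by
  obtain ⟨r, hr, hB⟩ := Metric.eventually_nhds_iff_ball.1 (hf.and h)
  filter_upwards [Metric.ball_mem_nhds x hr] with y hy
  exact Metric.isOpen_ball.is_const_of_fderiv_eq_zero (convex_ball x r).isPreconnected
    (fun z hz => (hB z hz).1.differentiableWithinAt)
    (fun z hz => fderiv_eq_zero_of_pderiv (hB z hz).2) hy (Metric.mem_ball_self hr)

end PartialDerivatives

/-! ### Linear algebra of Lagrangian planes in `ℂ²` -/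

/-- The complex determinant `(dz₁ ∧ dz₂)(v, w)`. -/
def cdet (v w : C2) : ℂ := v 0 * w 1 - v 1 * w 0

lemma inner_coord (v w : C2) : (inner ℝ v w : ℝ) =
    (v 0).re * (w 0).re + (v 0).im * (w 0).im + (v 1).re * (w 1).re + (v 1).im * (w 1).im := by
  simp [PiLp.inner_apply, Complex.inner]
  ring

lemma inner_I_right (v w : C2) : (inner ℝ v (Complex.I • w) : ℝ) = - kaehler v w := by
  simp [kaehler, inner_coord]; ring

lemma inner_I_left (v w : C2) : (inner ℝ (Complex.I • v) w : ℝ) = kaehler v w := rfl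

lemma kaehler_swap (v w : C2) : kaehler v w = - kaehler w v := by
  simp [kaehler, inner_coord]; ring

lemma kaehler_self (v : C2) : kaehler v v = 0 := by
  simp [kaehler, inner_coord]; ring

lemma inner_I_I (v w : C2) : (inner ℝ (Complex.I • v) (Complex.I • w) : ℝ) = inner ℝ v w := by
  simp [inner_coord]; ring

lemma normSq_cdet (a b : C2) : Complex.normSq (cdet a b) =
    inner ℝ a a * inner ℝ b b - inner ℝ a b ^ 2 - kaehler a b ^ 2 := by
  simp only [kaehler, inner_coord]
  simp [cdet, Complex.normSq_apply]; ring

lemma cdet_ne_zero {a b : C2} (hD : 0 < (inner ℝ a a * inner ℝ b b - inner ℝ a b ^ 2 : ℝ))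
    (hL : kaehler a b = 0) : cdet a b ≠ 0 := by
  rw [← Complex.normSq_pos, normSq_cdet, hL]; simpa using hD

/-- A vector orthogonal to a Lagrangian plane and to its normal plane vanishes. -/
lemma eq_zero_of_inner {a b q : C2}
    (hD : 0 < (inner ℝ a a * inner ℝ b b - inner ℝ a b ^ 2 : ℝ)) (hL : kaehler a b = 0)
    (ha : (inner ℝ q a : ℝ) = 0) (hb : (inner ℝ q b : ℝ) = 0)
    (hJa : kaehler q a = 0) (hJb : kaehler q b = 0) : q = 0 := by
  have hd := cdet_ne_zero hD hL
  have h1 : (starRingEnd ℂ) (q 0) * a 0 + (starRingEnd ℂ) (q 1) * a 1 = 0 := by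
    apply Complex.ext
    · simp [inner_coord] at ha ⊢; linarith
    · simp [kaehler, inner_coord] at hJa ⊢; linarith
  have h2 : (starRingEnd ℂ) (q 0) * b 0 + (starRingEnd ℂ) (q 1) * b 1 = 0 := by
    apply Complex.ext
    · simp [inner_coord] at hb ⊢; linarith
    · simp [kaehler, inner_coord] at hJb ⊢; linarith
  have h3 : cdet a b * (starRingEnd ℂ) (q 0) = 0 := by
    rw [cdet]; linear_combination b 1 * h1 - a 1 * h2
  have h4 : cdet a b * (starRingEnd ℂ) (q 1) = 0 := by
    rw [cdet]; linear_combination - b 0 * h1 + a 0 * h2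
  ext i
  fin_cases i
  · simpa [hd] using h3
  · simpa [hd] using h4

lemma gram_pos {a b : C2} (h : LinearIndependent ℝ ![a, b]) :
    0 < (inner ℝ a a * inner ℝ b b - inner ℝ a b ^ 2 : ℝ) := by
  have hb : b ≠ 0 := h.ne_zero 1
  have hG : 0 < (inner ℝ b b : ℝ) := real_inner_self_pos.2 hb
  have hne : (inner ℝ b b : ℝ) • a - (inner ℝ a b : ℝ) • b ≠ 0 := by
    intro h0
    rw [LinearIndependent.pair_iff] at h
    have := (h (inner ℝ b b) (-inner ℝ a b) (by rw [neg_smul, ← sub_eq_add_neg, h0])).1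
    exact hG.ne' this
  have := real_inner_self_pos.2 hne
  simp only [inner_sub_left, inner_sub_right, real_inner_smul_left, real_inner_smul_right,
    real_inner_comm a b] at this
  have h2 : 0 < (inner ℝ b b : ℝ) * (inner ℝ a a * inner ℝ b b - inner ℝ a b ^ 2 : ℝ) := by
    refine this.trans_eq ?_
    ring
  exact pos_of_mul_pos_right h2 hG.le

lemma kaehler_add_left (u v w : C2) : kaehler (u + v) w = kaehler u w + kaehler v w := by
  simp [kaehler, inner_add_left]

lemma kaehler_sub_left (u v w : C2) : kaehler (u - v) w = kaehler u w - kaehler v w := by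
  simp [kaehler, inner_sub_left, smul_sub]

lemma kaehler_smul_left (c : ℝ) (v w : C2) : kaehler (c • v) w = c * kaehler v w := by
  rw [kaehler, smul_comm, real_inner_smul_left, kaehler]

lemma kaehler_add_right (u v w : C2) : kaehler u (v + w) = kaehler u v + kaehler u w := by
  simp [kaehler, inner_add_right]

lemma kaehler_sub_right (u v w : C2) : kaehler u (v - w) = kaehler u v - kaehler u w := by
  simp [kaehler, inner_sub_right]

lemma kaehler_smul_right (c : ℝ) (v w : C2) : kaehler v (c • w) = c * kaehler v w := by
  rw [kaehler, real_inner_smul_right, kaehler]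

/-- Serves to read off the derivative of the phase of det(∂₀f, ∂₁f): with (a, b) the tangent frame
and (c, d) that frame with one vector differentiated, the two terms involving ω(a, b) or metric
derivatives separate, leaving a trace of the cubic form. -/
lemma im_conj_cdet_mul (a b c d : C2) : ((starRingEnd ℂ) (cdet a b) * cdet c d).im =
    inner ℝ a c * kaehler b d + kaehler a c * inner ℝ b d
      - inner ℝ a d * kaehler b c - kaehler a d * inner ℝ b c := by
  simp only [kaehler, inner_coord]
  simp [cdet]; ring

/-! ### The metric of a parametrized surface -/

lemma metric_apply (f : R2 → C2) (x : R2) (i j : Fin 2) :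
    metric f x i j = inner ℝ (pderiv i f x) (pderiv j f x) := rfl

lemma metric_comm (f : R2 → C2) (x : R2) : metric f x 1 0 = metric f x 0 1 :=
  real_inner_comm (pderiv 0 f x) (pderiv 1 f x)

lemma metric_det (f : R2 → C2) (x : R2) :
    (metric f x).det = metric f x 0 0 * metric f x 1 1 - metric f x 0 1 ^ 2 := by
  rw [Matrix.det_fin_two, metric_comm]; ring

lemma metric_inv_zero_zero (f : R2 → C2) (x : R2) :
    (metric f x)⁻¹ 0 0 = metric f x 1 1 / (metric f x).det := by
  simp [Matrix.inv_def, Matrix.adjugate_fin_two, div_eq_inv_mul]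

lemma metric_inv_one_one (f : R2 → C2) (x : R2) :
    (metric f x)⁻¹ 1 1 = metric f x 0 0 / (metric f x).det := by
  simp [Matrix.inv_def, Matrix.adjugate_fin_two, div_eq_inv_mul]

lemma metric_inv_zero_one (f : R2 → C2) (x : R2) :
    (metric f x)⁻¹ 0 1 = - metric f x 0 1 / (metric f x).det := by
  simp [Matrix.inv_def, Matrix.adjugate_fin_two, div_eq_inv_mul]

lemma metric_inv_one_zero (f : R2 → C2) (x : R2) :
    (metric f x)⁻¹ 1 0 = - metric f x 0 1 / (metric f x).det := by
  simp [Matrix.inv_def, Matrix.adjugate_fin_two, div_eq_inv_mul, metric_comm]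

/-- The pointwise algebra behind Δf = H: a, b are the first derivatives of f, a₁, m, b₂ the second
ones, n is H and W the area density. Both sides are compared on the basis a, b, Ja, Jb. Against a
and b the left side cancels, which is the tangency part of Δf = H and uses only W² = EG - F².
Against Ja and Jb the derivatives of the metric drop out by ω(a, b) = 0, and what remains is the
hypothesis on n. -/
lemma laplacian_frame {a b a₁ m b₂ n : C2} {W E F F' G : ℝ} (hW : 0 < W)
    (hW2 : W ^ 2 = E * G - F ^ 2) (hL : kaehler a b = 0) (hE : E = inner ℝ a a)
    (hF : F = inner ℝ a b) (hF' : F' = inner ℝ b a) (hG : G = inner ℝ b b)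
    (hna : (inner ℝ n a : ℝ) = 0) (hnb : (inner ℝ n b : ℝ) = 0)
    (hka : kaehler a n * W ^ 2 = G * kaehler a a₁ - 2 * F * kaehler a m + E * kaehler a b₂)
    (hkb : kaehler b n * W ^ 2 = G * kaehler b a₁ - 2 * F * kaehler b m + E * kaehler b b₂) :
    W⁻¹ • ((G • a₁ + (inner ℝ m b + inner ℝ b m : ℝ) • a) -
        (F' • m + (inner ℝ m a + inner ℝ b a₁ : ℝ) • b)) +
      (-(E * (2 * inner ℝ m b) + G * (2 * inner ℝ a₁ a) -
        2 * F * (inner ℝ a₁ b + inner ℝ m a)) / (2 * W ^ 3)) • (G • a - F' • b) -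
    (W⁻¹ • ((F • m + (inner ℝ m b + inner ℝ a b₂ : ℝ) • a) -
        (E • b₂ + (inner ℝ m a + inner ℝ a m : ℝ) • b)) +
      (-(E * (2 * inner ℝ b₂ b) + G * (2 * inner ℝ m a) -
        2 * F * (inner ℝ m b + inner ℝ b₂ a)) / (2 * W ^ 3)) • (F • a - E • b)) = W • n := by
  have hFF : F' = F := by rw [hF', hF, real_inner_comm]
  have hL' : kaehler b a = 0 := by rw [kaehler_swap, hL, neg_zero]
  have hpos : 0 < (inner ℝ a a * inner ℝ b b - inner ℝ a b ^ 2 : ℝ) := by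
    rw [← hE, ← hF, ← hG, ← hW2]; positivity
  rw [← sub_eq_zero]
  simp only [real_inner_comm m b, real_inner_comm m a, real_inner_comm a₁ b, real_inner_comm b₂ a,
    hFF]
  rw [hF', real_inner_comm] at hFF
  refine eq_zero_of_inner hpos hL ?_ ?_ ?_ ?_
  · simp only [inner_sub_left, inner_add_left, real_inner_smul_left, hna, ← hE,
      real_inner_comm a b, ← hF]
    field_simp
    linear_combination (G * inner ℝ a₁ a + inner ℝ m b * E - F * inner ℝ m a -
      F * inner ℝ a₁ b) * hW2
  · simp only [inner_sub_left, inner_add_left, real_inner_smul_left, hnb, ← hG, ← hF]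
    field_simp
    linear_combination (G * inner ℝ m a - inner ℝ m b * F - F * inner ℝ b₂ a +
      E * inner ℝ b₂ b) * hW2
  · rw [kaehler_swap, neg_eq_zero]
    simp only [kaehler_sub_right, kaehler_add_right, kaehler_smul_right, kaehler_self, hL]
    field_simp
    linear_combination (-W ^ 2) * hka
  · rw [kaehler_swap, neg_eq_zero]
    simp only [kaehler_sub_right, kaehler_add_right, kaehler_smul_right, kaehler_self, hL']
    field_simp
    linear_combination (-W ^ 2) * hkb

/-- A parametrized Lagrangian surface in `ℂ²`, over an open set of parameters. -/
structure IsLagrangianPatch (f : R2 → C2) (V : Set R2) : Prop where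
  isOpen : IsOpen V
  contDiffAt : ∀ x ∈ V, ContDiffAt ℝ ∞ f x
  injective : ∀ x ∈ V, Function.Injective (fderiv ℝ f x)
  lagrangian : ∀ x ∈ V, ∀ i j, kaehler (pderiv i f x) (pderiv j f x) = 0

/-- The differential of `f`, composed with the Hodge star of the induced metric, evaluated on
the coordinate field `∂ₖ`. -/
noncomputable def conjDiff (f : R2 → C2) (k : Fin 2) (x : R2) : C2 :=
  (areaDensity f x)⁻¹ • (metric f x k 1 • pderiv 0 f x - metric f x k 0 • pderiv 1 f x)

/-! ### Normal parts -/

lemma inner_normalPart_pderiv (f : R2 → C2) (x : R2) (v : C2) (i : Fin 2) :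
    (inner ℝ (normalPart f x v) (pderiv i f x) : ℝ) = 0 := by
  have h1 : normalPart f x v ∈ (LinearMap.range (fderiv ℝ f x).toLinearMap)ᗮ :=
    Submodule.starProjection_apply_mem _ _
  rw [Submodule.mem_orthogonal'] at h1
  exact h1 _ ⟨_, rfl⟩

lemma sub_normalPart_mem (f : R2 → C2) (x : R2) (v : C2) :
    ∃ h : R2, v - normalPart f x v = fderiv ℝ f x h := by
  have h1 : v - normalPart f x v ∈ (LinearMap.range (fderiv ℝ f x).toLinearMap)ᗮᗮ :=
    Submodule.sub_starProjection_mem_orthogonal _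
  rw [Submodule.orthogonal_orthogonal] at h1
  obtain ⟨h, hh⟩ := h1
  exact ⟨h, hh.symm⟩

lemma normalPart_eq_of {f : R2 → C2} {x : R2} {v n : C2}
    (hn : ∀ i, (inner ℝ n (pderiv i f x) : ℝ) = 0) {h : R2} (hv : v - n = fderiv ℝ f x h) :
    normalPart f x v = n := by
  refine Submodule.eq_starProjection_of_mem_orthogonal ?_ ?_
  · rw [Submodule.mem_orthogonal']
    rintro _ ⟨k, rfl⟩
    simp [fderiv_eq_pderiv, inner_add_right, real_inner_smul_right, hn]
  · rw [Submodule.orthogonal_orthogonal, hv]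
    exact ⟨h, rfl⟩

/-! ### The cubic form and the identity d*df = H dA. -/

namespace IsLagrangianPatch

variable {f : R2 → C2} {V : Set R2} {x : R2} (hf : IsLagrangianPatch f V) (hx : x ∈ V)
include hf hx

lemma mem_nhds : V ∈ nhds x := hf.isOpen.mem_nhds hx

lemma contDiffAt_pderiv (i : Fin 2) : ContDiffAt ℝ ∞ (pderiv i f) x :=
  LagrangianSoliton.contDiffAt_pderiv (hf.contDiffAt x hx) i

lemma contDiffAt_metric (i j : Fin 2) : ContDiffAt ℝ ∞ (fun y => metric f y i j) x :=
  (hf.contDiffAt_pderiv hx i).inner ℝ (hf.contDiffAt_pderiv hx j)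

lemma det_pos : 0 < (metric f x).det := by
  rw [metric_det]
  refine gram_pos ?_
  rw [LinearIndependent.pair_iff]
  intro s t hst
  have h1 : fderiv ℝ f x (!₂[s, t] : R2) = fderiv ℝ f x 0 := by
    rw [fderiv_eq_pderiv]; simpa using hst
  have h2 := hf.injective x hx h1
  exact ⟨by simpa using congrArg (fun v : R2 => v 0) h2,
    by simpa using congrArg (fun v : R2 => v 1) h2⟩

lemma areaDensity_pos : 0 < areaDensity f x := Real.sqrt_pos.2 (hf.det_pos hx)

lemma areaDensity_sq : areaDensity f x ^ 2 = (metric f x).det :=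
  Real.sq_sqrt (hf.det_pos hx).le

lemma contDiffAt_det : ContDiffAt ℝ ∞ (fun y => (metric f y).det) x := by
  simp only [metric_det]
  exact ((hf.contDiffAt_metric hx 0 0).mul (hf.contDiffAt_metric hx 1 1)).sub
    ((hf.contDiffAt_metric hx 0 1).pow 2)

lemma contDiffAt_areaDensity : ContDiffAt ℝ ∞ (areaDensity f) x :=
  (hf.contDiffAt_det hx).sqrt (hf.det_pos hx).ne'

lemma contDiffAt_conjDiff (k : Fin 2) : ContDiffAt ℝ ∞ (conjDiff f k) x :=
  ((hf.contDiffAt_areaDensity hx).inv (hf.areaDensity_pos hx).ne').smul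
    (((hf.contDiffAt_metric hx k 1).smul (hf.contDiffAt_pderiv hx 0)).sub
      ((hf.contDiffAt_metric hx k 0).smul (hf.contDiffAt_pderiv hx 1)))

/-- The difference between a vector and its normal part is tangent, and ω vanishes on the tangent
plane. This lets the projections disappear from every normal component. -/
lemma kaehler_normalPart (v : C2) (i : Fin 2) :
    kaehler (pderiv i f x) (normalPart f x v) = kaehler (pderiv i f x) v := by
  obtain ⟨h, hh⟩ := sub_normalPart_mem f x v
  have : kaehler (pderiv i f x) (v - normalPart f x v) = 0 := by
    rw [hh, fderiv_eq_pderiv]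
    simp [kaehler_add_right, kaehler_smul_right, hf.lagrangian x hx]
  rw [kaehler_sub_right] at this
  linarith

lemma pderiv_metric (k i j : Fin 2) : pderiv k (fun y => metric f y i j) x =
    inner ℝ (pderiv k (pderiv i f) x) (pderiv j f x) +
      inner ℝ (pderiv i f x) (pderiv k (pderiv j f) x) :=
  pderiv_inner (ContDiffAt.diff (hf.contDiffAt_pderiv hx i))
    (ContDiffAt.diff (hf.contDiffAt_pderiv hx j)) k

lemma pderiv_kaehler (k i j : Fin 2) : kaehler (pderiv k (pderiv i f) x) (pderiv j f x) +
    kaehler (pderiv i f x) (pderiv k (pderiv j f) x) = 0 := by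
  have h1 := pderiv_inner (i := k) (f := fun y => Complex.I • pderiv i f y) (x := x)
    ((ContDiffAt.diff (hf.contDiffAt_pderiv hx i)).fun_const_smul _)
    (ContDiffAt.diff (hf.contDiffAt_pderiv hx j))
  have h2 : (fun y => (inner ℝ (Complex.I • pderiv i f y) (pderiv j f y) : ℝ)) =ᶠ[nhds x]
      fun _ => 0 := by
    filter_upwards [hf.mem_nhds hx] with y hy using hf.lagrangian y hy i j
  rw [pderiv_congr h2, pderiv_const] at h1
  have h3 : pderiv k (fun y => Complex.I • pderiv i f y) x =
      Complex.I • pderiv k (pderiv i f) x := by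
    rw [pderiv, fderiv_fun_const_smul (ContDiffAt.diff (hf.contDiffAt_pderiv hx i))]
    rfl
  rw [h3] at h1
  exact h1.symm

/-- The cubic form `⟨σ(∂ₖ, ∂ᵢ), J ∂ⱼ⟩` is symmetric. -/
lemma cubic_symm (k i j : Fin 2) : kaehler (pderiv j f x) (pderiv k (pderiv i f) x) =
    kaehler (pderiv i f x) (pderiv k (pderiv j f) x) := by
  have := hf.pderiv_kaehler hx k i j
  rw [kaehler_swap (pderiv j f x)]
  linarith

lemma pderiv_det (k : Fin 2) : pderiv k (fun y => (metric f y).det) x =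
    metric f x 0 0 * (2 * inner ℝ (pderiv k (pderiv 1 f) x) (pderiv 1 f x)) +
    metric f x 1 1 * (2 * inner ℝ (pderiv k (pderiv 0 f) x) (pderiv 0 f x)) -
    2 * metric f x 0 1 * (inner ℝ (pderiv k (pderiv 0 f) x) (pderiv 1 f x) +
      inner ℝ (pderiv k (pderiv 1 f) x) (pderiv 0 f x)) := by
  simp only [metric_det, pow_two]
  have d := fun i j => ContDiffAt.diff (hf.contDiffAt_metric hx i j)
  rw [pderiv_sub ((d 0 0).fun_mul (d 1 1)) ((d 0 1).fun_mul (d 0 1)), pderiv_mul (d 0 0) (d 1 1),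
    pderiv_mul (d 0 1) (d 0 1)]
  simp only [hf.pderiv_metric hx]
  rw [real_inner_comm (pderiv 1 f x) (pderiv k (pderiv 1 f) x),
    real_inner_comm (pderiv 0 f x) (pderiv k (pderiv 0 f) x),
    real_inner_comm (pderiv 0 f x) (pderiv k (pderiv 1 f) x)]
  ring

lemma pderiv_areaDensity_inv (k : Fin 2) : pderiv k (fun y => (areaDensity f y)⁻¹) x =
    - pderiv k (fun y => (metric f y).det) x / (2 * areaDensity f x ^ 3) := by
  have hW := hf.areaDensity_pos hx
  have h1 : HasDerivAt (fun t : ℝ => (√t)⁻¹)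
      (-(1 / (2 * √(metric f x).det)) / (√(metric f x).det) ^ 2) (metric f x).det :=
    (Real.hasDerivAt_sqrt (hf.det_pos hx).ne').inv hW.ne'
  have h2 := pderiv_comp h1 (ContDiffAt.diff (hf.contDiffAt_det hx)) k
  unfold areaDensity at hW ⊢
  rw [h2, smul_eq_mul]
  field_simp

lemma pderiv_conjDiff (l k : Fin 2) : pderiv l (conjDiff f k) x =
    (areaDensity f x)⁻¹ •
      ((metric f x k 1 • pderiv l (pderiv 0 f) x +
          pderiv l (fun y => metric f y k 1) x • pderiv 0 f x) -
        (metric f x k 0 • pderiv l (pderiv 1 f) x +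
          pderiv l (fun y => metric f y k 0) x • pderiv 1 f x)) +
    (- pderiv l (fun y => (metric f y).det) x / (2 * areaDensity f x ^ 3)) •
      (metric f x k 1 • pderiv 0 f x - metric f x k 0 • pderiv 1 f x) := by
  have d := fun i j => ContDiffAt.diff (hf.contDiffAt_metric hx i j)
  have d' := fun i => ContDiffAt.diff (hf.contDiffAt_pderiv hx i)
  have dW := ((ContDiffAt.diff (hf.contDiffAt_areaDensity hx)).fun_inv
    (hf.areaDensity_pos hx).ne')
  unfold conjDiff
  rw [pderiv_smul dW (((d k 1).fun_smul (d' 0)).fun_sub ((d k 0).fun_smul (d' 1))),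
    pderiv_sub ((d k 1).fun_smul (d' 0)) ((d k 0).fun_smul (d' 1)),
    pderiv_smul (d k 1) (d' 0), pderiv_smul (d k 0) (d' 1), hf.pderiv_areaDensity_inv hx]

/-- The component `⟨H, J ∂ₖ⟩` of the mean curvature vector. -/
lemma kaehler_meanCurvature (k : Fin 2) :
    kaehler (pderiv k f x) (meanCurvature f x) * (metric f x).det =
      metric f x 1 1 * kaehler (pderiv k f x) (pderiv 0 (pderiv 0 f) x) -
      2 * metric f x 0 1 * kaehler (pderiv k f x) (pderiv 0 (pderiv 1 f) x) +
      metric f x 0 0 * kaehler (pderiv k f x) (pderiv 1 (pderiv 1 f) x) := by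
  have hD := (hf.det_pos hx).ne'
  simp only [meanCurvature, secondFundamentalForm, Fin.sum_univ_two, kaehler_add_right,
    kaehler_smul_right, hf.kaehler_normalPart hx, metric_inv_zero_zero, metric_inv_zero_one,
    metric_inv_one_zero, metric_inv_one_one, pderiv_comm (hf.contDiffAt x hx) 1 0]
  field_simp
  ring

/-- The mean curvature vector is the Laplacian of the immersion. -/
lemma laplacian_eq_meanCurvature :
    pderiv 0 (conjDiff f 1) x - pderiv 1 (conjDiff f 0) x =
      areaDensity f x • meanCurvature f x := by
  have hm : ∀ i, (inner ℝ (meanCurvature f x) (pderiv i f x) : ℝ) = 0 := by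
    intro i
    simp only [meanCurvature, secondFundamentalForm, Fin.sum_univ_two, inner_add_left,
      real_inner_smul_left, inner_normalPart_pderiv, mul_zero, add_zero]
  have hk := hf.kaehler_meanCurvature hx
  rw [← hf.areaDensity_sq hx] at hk
  rw [hf.pderiv_conjDiff hx, hf.pderiv_conjDiff hx, hf.pderiv_det hx, hf.pderiv_det hx,
    hf.pderiv_metric hx, hf.pderiv_metric hx, hf.pderiv_metric hx, hf.pderiv_metric hx,
    pderiv_comm (hf.contDiffAt x hx) 1 0]
  refine laplacian_frame (hf.areaDensity_pos hx) ?_ (hf.lagrangian x hx 0 1) rfl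
    (metric_apply f x 0 1) (metric_apply f x 1 0) rfl (hm 0) (hm 1) (hk 0) (hk 1)
  rw [hf.areaDensity_sq hx, metric_det]

end IsLagrangianPatch

/-! ### The Lagrangian angle -/

lemma pderiv_coord {g : R2 → C2} {x : R2} (hg : DifferentiableAt ℝ g x) (k j : Fin 2) :
    pderiv k (fun y => g y j) x = pderiv k g x j :=
  pderiv_clm ((EuclideanSpace.proj j : C2 →L[ℂ] ℂ).restrictScalars ℝ) hg k

lemma differentiableAt_coord {g : R2 → C2} {x : R2} (hg : DifferentiableAt ℝ g x) (j : Fin 2) :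
    DifferentiableAt ℝ (fun y => g y j) x :=
  ((EuclideanSpace.proj j : C2 →L[ℂ] ℂ).restrictScalars ℝ).differentiableAt.comp x hg

lemma pderiv_cdet {g h : R2 → C2} {x : R2} (hg : DifferentiableAt ℝ g x)
    (hh : DifferentiableAt ℝ h x) (k : Fin 2) :
    pderiv k (fun y => cdet (g y) (h y)) x = cdet (pderiv k g x) (h x) + cdet (g x) (pderiv k h x) := by
  have dg := differentiableAt_coord hg
  have dh := differentiableAt_coord hh
  unfold cdet
  rw [pderiv_sub ((dg 0).fun_mul (dh 1)) ((dg 1).fun_mul (dh 0)), pderiv_mul (dg 0) (dh 1),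
    pderiv_mul (dg 1) (dh 0)]
  simp only [pderiv_coord hg, pderiv_coord hh]
  ring

lemma pderiv_exp_I_mul {β : R2 → ℝ} {x : R2} (hβ : DifferentiableAt ℝ β x) (k : Fin 2) :
    pderiv k (fun y => Complex.exp (Complex.I * (β y : ℂ))) x =
      pderiv k β x * (Complex.I * Complex.exp (Complex.I * (β x : ℂ))) := by
  have h : HasDerivAt (fun t : ℝ => Complex.exp (Complex.I * (t : ℂ)))
      (Complex.exp (Complex.I * (β x : ℂ)) * (Complex.I * 1)) (β x) :=
    ((Complex.ofRealCLM.hasDerivAt (x := β x)).const_mul Complex.I).cexp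
  rw [pderiv_comp h hβ, Complex.real_smul]
  ring

lemma pderiv_ofReal {g : R2 → ℝ} {x : R2} (hg : DifferentiableAt ℝ g x) (k : Fin 2) :
    pderiv k (fun y => (g y : ℂ)) x = pderiv k g x :=
  pderiv_clm Complex.ofRealCLM hg k

lemma differentiableAt_ofReal {g : R2 → ℝ} {x : R2} (hg : DifferentiableAt ℝ g x) :
    DifferentiableAt ℝ (fun y => (g y : ℂ)) x :=
  Complex.ofRealCLM.differentiableAt.comp x hg

lemma differentiableAt_exp_I_mul {β : R2 → ℝ} {x : R2} (hβ : DifferentiableAt ℝ β x) :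
    DifferentiableAt ℝ (fun y => Complex.exp (Complex.I * (β y : ℂ))) x :=
  ((Complex.ofRealCLM.differentiableAt.comp x hβ).const_mul Complex.I).cexp

lemma conj_exp_mul (t : ℝ) : (starRingEnd ℂ) (Complex.exp (Complex.I * t)) *
    Complex.exp (Complex.I * t) = 1 := by
  rw [← Complex.exp_conj, ← Complex.exp_add]
  simp

/-- The mean curvature vector of a Lagrangian surface is `J ∇ β`. -/
lemma IsLagrangianPatch.pderiv_angle {f : R2 → C2} {V : Set R2} {x : R2}
    (hf : IsLagrangianPatch f V) (hx : x ∈ V) {U : Set R2} (hU : IsOpen U) (hxU : x ∈ U)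
    {β : R2 → ℝ} (hβ : IsLagrangianAngleOn f U β) (k : Fin 2) :
    pderiv k β x = kaehler (pderiv k f x) (meanCurvature f x) := by
  have dβ : DifferentiableAt ℝ β x :=
    ContDiffAt.diff (hβ.1.contDiffAt (hU.mem_nhds hxU))
  have dW := ContDiffAt.diff (hf.contDiffAt_areaDensity hx)
  have df := fun i => ContDiffAt.diff (hf.contDiffAt_pderiv hx i)
  have hloc : (fun y => cdet (pderiv 0 f y) (pderiv 1 f y)) =ᶠ[nhds x]
      fun y => Complex.exp (Complex.I * (β y : ℂ)) * (areaDensity f y : ℂ) := by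
    filter_upwards [hU.mem_nhds hxU] with y hy using hβ.2 y hy
  have h1 := pderiv_congr hloc k
  rw [pderiv_cdet (df 0) (df 1), pderiv_mul (differentiableAt_exp_I_mul dβ)
    (differentiableAt_ofReal dW), pderiv_exp_I_mul dβ,
    pderiv_ofReal dW] at h1
  -- Multiplying by the conjugate of the determinant removes the phase e^{iβ}. The real part then
  -- only concerns the area density, and the imaginary part is det g · ∂ₖβ.
  have h2 : (starRingEnd ℂ) (cdet (pderiv 0 f x) (pderiv 1 f x)) *
      (cdet (pderiv k (pderiv 0 f) x) (pderiv 1 f x) +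
        cdet (pderiv 0 f x) (pderiv k (pderiv 1 f) x)) =
      areaDensity f x * ((pderiv k (areaDensity f) x : ℝ) : ℂ) +
        Complex.I * (areaDensity f x ^ 2 * pderiv k β x : ℝ) := by
    rw [h1, show cdet (pderiv 0 f x) (pderiv 1 f x) = _ from hβ.2 x hxU, map_mul,
      Complex.conj_ofReal]
    push_cast
    linear_combination (areaDensity f x * ((pderiv k (areaDensity f) x : ℝ) : ℂ) +
        Complex.I * (areaDensity f x ^ 2 * (pderiv k β x : ℝ))) * conj_exp_mul (β x)
  have h3 := congrArg Complex.im h2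
  rw [mul_add, Complex.add_im, im_conj_cdet_mul, im_conj_cdet_mul, ← Complex.ofReal_mul,
    Complex.add_im, Complex.ofReal_im, Complex.I_mul_im, Complex.ofReal_re,
    hf.areaDensity_sq hx] at h3
  have hL := hf.lagrangian x hx
  have hm := hf.kaehler_meanCurvature hx k
  have hD := (hf.det_pos hx).ne'
  simp only [hL, metric_apply, hf.cubic_symm hx k 0 1] at h3 hm
  refine mul_right_cancel₀ hD ?_
  rw [hm, mul_comm, ← zero_add (Matrix.det _ * _), ← h3]
  have hF := real_inner_comm (pderiv 0 f x) (pderiv 1 f x)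
  have s1 := hf.cubic_symm hx 0 0 1
  have s2 := hf.cubic_symm hx 1 0 1
  have s3 := pderiv_comm (hf.contDiffAt x hx) 1 0
  fin_cases k
  · simp only [Fin.zero_eta, Fin.isValue]
    rw [s3] at s2
    rw [s2, hF]
    ring
  · simp only [Fin.mk_one, Fin.isValue]
    rw [s3] at s2 ⊢
    rw [s1, s2, hF]
    ring

/-! ### Hamiltonian stationary translating solitons -/

/-- A parametrized Hamiltonian stationary Lagrangian surface in `ℂ²` with `H = e^⊥`. -/
structure IsSolitonPatch (f : R2 → C2) (V : Set R2) (e : C2) : Prop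
    extends IsLagrangianPatch f V where
  translating : ∀ x ∈ V, meanCurvature f x = normalPart f x e
  stationary : ∀ x ∈ V, ∃ U : Set R2, IsOpen U ∧ x ∈ U ∧ U ⊆ V ∧
    ∃ β : R2 → ℝ, IsLagrangianAngleOn f U β ∧ ∀ y ∈ U, laplaceBeltrami f β y = 0

lemma inner_conjDiff (f : R2 → C2) (x : R2) (y : C2) (k : Fin 2) : (inner ℝ y (conjDiff f k x) : ℝ) =
    (metric f x k 1 * inner ℝ y (pderiv 0 f x) - metric f x k 0 * inner ℝ y (pderiv 1 f x)) /
      areaDensity f x := by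
  rw [conjDiff, real_inner_smul_right, inner_sub_right, real_inner_smul_right,
    real_inner_smul_right, div_eq_inv_mul]

lemma kaehler_conjDiff (f : R2 → C2) (x : R2) (y : C2) (k : Fin 2) : kaehler y (conjDiff f k x) =
    (metric f x k 1 * kaehler y (pderiv 0 f x) - metric f x k 0 * kaehler y (pderiv 1 f x)) /
      areaDensity f x :=
  inner_conjDiff f x (Complex.I • y) k

lemma inner_normalPart_self (f : R2 → C2) (x : R2) (e : C2) :
    (inner ℝ (normalPart f x e) (normalPart f x e) : ℝ) = inner ℝ e (normalPart f x e) := by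
  obtain ⟨h, hh⟩ := sub_normalPart_mem f x e
  have : (inner ℝ (e - normalPart f x e) (normalPart f x e) : ℝ) = 0 := by
    rw [hh, fderiv_eq_pderiv, real_inner_comm]
    simp [inner_add_right, real_inner_smul_right, inner_normalPart_pderiv]
  rw [inner_sub_left] at this
  linarith

/-! ### Tangential and normal components of a constant vector. -/

namespace IsLagrangianPatch

variable {f : R2 → C2} {V : Set R2} {x : R2} (hf : IsLagrangianPatch f V) (hx : x ∈ V)
include hf hx

lemma metric_mul_sub : metric f x 0 0 * metric f x 1 1 - metric f x 0 1 ^ 2 =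
    areaDensity f x ^ 2 := by
  rw [hf.areaDensity_sq hx, metric_det]

lemma ext_of_inner {p q : C2} (h : ∀ i, (inner ℝ p (pderiv i f x) : ℝ) = inner ℝ q (pderiv i f x))
    (h' : ∀ i, kaehler p (pderiv i f x) = kaehler q (pderiv i f x)) : p = q := by
  have hpos := hf.det_pos hx
  rw [metric_det] at hpos
  rw [← sub_eq_zero]
  refine eq_zero_of_inner hpos (hf.lagrangian x hx 0 1) ?_ ?_ ?_ ?_
  · rw [inner_sub_left, h, sub_self]
  · rw [inner_sub_left, h, sub_self]
  · rw [kaehler_sub_left, h', sub_self]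
  · rw [kaehler_sub_left, h', sub_self]

/-- The expansion of a vector in the frame `∂₀ f, ∂₁ f`. -/
lemma decomposition (e : C2) : areaDensity f x • e =
    ((inner ℝ e (conjDiff f 1 x) : ℝ) • pderiv 0 f x -
      (inner ℝ e (conjDiff f 0 x) : ℝ) • pderiv 1 f x) -
    (kaehler e (conjDiff f 1 x) • Complex.I • pderiv 0 f x -
      kaehler e (conjDiff f 0 x) • Complex.I • pderiv 1 f x) := by
  have hW := (hf.areaDensity_pos hx).ne'
  have hD := hf.metric_mul_sub hx
  have hL := hf.lagrangian x hx
  have hc := metric_comm f x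
  have key : ∀ v w : C2, kaehler (Complex.I • v) w = - inner ℝ v w := by
    intro v w; simp [kaehler, inner_coord]; ring
  apply hf.ext_of_inner hx
  · intro i
    simp only [inner_sub_left, real_inner_smul_left, inner_I_left, hL, inner_conjDiff,
      ← metric_apply]
    fin_cases i
    · simp only [Fin.zero_eta, hc]
      field_simp
      linear_combination (-inner ℝ e (pderiv 0 f x)) * hD
    · simp only [Fin.mk_one, hc]
      field_simp
      linear_combination (-inner ℝ e (pderiv 1 f x)) * hD
  · intro i
    simp only [kaehler_sub_left, kaehler_smul_left, key, hL, kaehler_conjDiff,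
      ← metric_apply]
    fin_cases i
    · simp only [Fin.zero_eta, hc]
      field_simp
      linear_combination (-kaehler e (pderiv 0 f x)) * hD
    · simp only [Fin.mk_one, hc]
      field_simp
      linear_combination (-kaehler e (pderiv 1 f x)) * hD

lemma decomposition_normalPart (e : C2) : areaDensity f x • normalPart f x e =
    kaehler e (conjDiff f 0 x) • Complex.I • pderiv 1 f x -
      kaehler e (conjDiff f 1 x) • Complex.I • pderiv 0 f x := by
  rw [hf.decomposition hx]
  have h1 : ∀ k, (inner ℝ (normalPart f x e) (conjDiff f k x) : ℝ) = 0 := by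
    intro k
    simp [inner_conjDiff, inner_normalPart_pderiv]
  have h2 : ∀ k, kaehler (normalPart f x e) (conjDiff f k x) = kaehler e (conjDiff f k x) := by
    intro k
    simp only [kaehler_conjDiff, kaehler_swap _ (pderiv _ f x), hf.kaehler_normalPart hx]
  simp only [h1, h2]
  module

/-- `|e^⊥|² dA = *dv ∧ dv` for `v = ⟨J e, f⟩`. -/
lemma inner_normalPart (e : C2) : areaDensity f x * inner ℝ e (normalPart f x e) =
    kaehler e (conjDiff f 1 x) * kaehler e (pderiv 0 f x) -
      kaehler e (conjDiff f 0 x) * kaehler e (pderiv 1 f x) := by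
  rw [← real_inner_smul_right, hf.decomposition_normalPart hx, inner_sub_right,
    real_inner_smul_right, real_inner_smul_right, inner_I_right, inner_I_right]
  ring

lemma kaehler_normalPart_self (e : C2) : areaDensity f x * kaehler e (normalPart f x e) =
    kaehler e (conjDiff f 0 x) * inner ℝ e (pderiv 1 f x) -
      kaehler e (conjDiff f 1 x) * inner ℝ e (pderiv 0 f x) := by
  rw [← kaehler_smul_right, hf.decomposition_normalPart hx, kaehler_sub_right,
    kaehler_smul_right, kaehler_smul_right]
  simp only [← inner_I_left, inner_I_I]

/-- Pythagoras: the first two terms are the area density times the squared length of the tangential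
part of e, which is the gradient of ⟨e, f⟩. -/
lemma inner_self_eq (e : C2) : areaDensity f x * inner ℝ e e =
    inner ℝ e (conjDiff f 1 x) * inner ℝ e (pderiv 0 f x) -
      inner ℝ e (conjDiff f 0 x) * inner ℝ e (pderiv 1 f x) +
    areaDensity f x * inner ℝ e (normalPart f x e) := by
  rw [hf.inner_normalPart hx]
  conv_lhs => rw [← real_inner_smul_right, hf.decomposition hx]
  simp only [inner_sub_right, real_inner_smul_right, inner_I_right]
  ring

/-- Read with complex coefficients, `decomposition` expresses e in the complex basis ∂₀f, ∂₁f;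
taking the complex determinant with ∂ₖf leaves one coefficient. It turns the differential of det(e,
f) into the Lagrangian angle and the differentials of u and v. -/
lemma cdet_pderiv (e : C2) (k : Fin 2) : areaDensity f x * cdet e (pderiv k f x) =
    (inner ℝ e (conjDiff f k x) - Complex.I * kaehler e (conjDiff f k x)) * complexDet f x := by
  have h := hf.decomposition hx e
  have h0 := congrArg (fun y : C2 => y 0) h
  have h1 := congrArg (fun y : C2 => y 1) h
  simp at h0 h1
  simp only [cdet, complexDet]
  fin_cases k
  · simp only [Fin.zero_eta]
    linear_combination (pderiv 0 f x 1) * h0 - (pderiv 0 f x 0) * h1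
  · simp only [Fin.mk_one]
    linear_combination (pderiv 1 f x 1) * h0 - (pderiv 1 f x 0) * h1

end IsLagrangianPatch

/-! ### The differential equations for the heights u = ⟨e, f⟩ and v = ⟨Je, f⟩. -/

namespace IsSolitonPatch

variable {f : R2 → C2} {V : Set R2} {e : C2} {x : R2} (hf : IsSolitonPatch f V e) (hx : x ∈ V)
include hf hx

lemma pderiv_height (y : C2) (k : Fin 2) :
    pderiv k (fun z => (inner ℝ y (f z) : ℝ)) x = inner ℝ y (pderiv k f x) :=
  pderiv_const_inner y (ContDiffAt.diff (hf.contDiffAt x hx)) k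

lemma pderiv_inner_conjDiff (y : C2) (l k : Fin 2) :
    pderiv l (fun z => (inner ℝ y (conjDiff f k z) : ℝ)) x = inner ℝ y (pderiv l (conjDiff f k) x) :=
  pderiv_const_inner y (ContDiffAt.diff (hf.contDiffAt_conjDiff hx k)) l

lemma contDiffAt_height (y : C2) : ContDiffAt ℝ ∞ (fun z => (inner ℝ y (f z) : ℝ)) x :=
  contDiffAt_const.inner ℝ (hf.contDiffAt x hx)

lemma contDiffAt_inner_pderiv (y : C2) (k : Fin 2) :
    ContDiffAt ℝ ∞ (fun z => (inner ℝ y (pderiv k f z) : ℝ)) x :=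
  contDiffAt_const.inner ℝ (hf.contDiffAt_pderiv hx k)

lemma contDiffAt_inner_conjDiff (y : C2) (k : Fin 2) :
    ContDiffAt ℝ ∞ (fun z => (inner ℝ y (conjDiff f k z) : ℝ)) x :=
  contDiffAt_const.inner ℝ (hf.contDiffAt_conjDiff hx k)

/-- `d (*du) = |e^⊥|² dA` for `u = ⟨e, f⟩`. -/
lemma laplacian_re : pderiv 0 (fun z => (inner ℝ e (conjDiff f 1 z) : ℝ)) x -
    pderiv 1 (fun z => (inner ℝ e (conjDiff f 0 z) : ℝ)) x =
      areaDensity f x * inner ℝ e (normalPart f x e) := by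
  rw [hf.pderiv_inner_conjDiff hx, hf.pderiv_inner_conjDiff hx, ← inner_sub_right,
    hf.laplacian_eq_meanCurvature hx, real_inner_smul_right, hf.translating x hx]

lemma pderiv_angle_eq {U : Set R2} (hU : IsOpen U) (hxU : x ∈ U)
    {β : R2 → ℝ} (hβ : IsLagrangianAngleOn f U β) (k : Fin 2) :
    pderiv k β x = - kaehler e (pderiv k f x) := by
  rw [hf.pderiv_angle hx hU hxU hβ, hf.translating x hx, hf.kaehler_normalPart hx, kaehler_swap]

/-- `v = ⟨J e, f⟩` is harmonic: `d (*dv) = 0`. -/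
lemma laplacian_im : pderiv 0 (fun z => kaehler e (conjDiff f 1 z)) x =
    pderiv 1 (fun z => kaehler e (conjDiff f 0 z)) x := by
  obtain ⟨U, hU, hxU, hUV, β, hβ, hΔ⟩ := hf.stationary x hx
  have h := hΔ x hxU
  -- Because dβ = -dv, the two fluxes in the Laplacian of β are, up to sign, the components of *dv.
  have e0 : (fun y => areaDensity f y * ∑ j, (metric f y)⁻¹ 0 j * pderiv j β y) =ᶠ[nhds x]
      fun z => - kaehler e (conjDiff f 1 z) := by
    filter_upwards [hU.mem_nhds hxU] with y hy
    have hW := (hf.areaDensity_pos (hUV hy)).ne'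
    rw [Fin.sum_univ_two, hf.pderiv_angle_eq (hUV hy) hU hy hβ,
      hf.pderiv_angle_eq (hUV hy) hU hy hβ, metric_inv_zero_zero, metric_inv_zero_one,
      ← hf.areaDensity_sq (hUV hy), kaehler_conjDiff, metric_comm]
    field_simp
    ring
  have e1 : (fun y => areaDensity f y * ∑ j, (metric f y)⁻¹ 1 j * pderiv j β y) =ᶠ[nhds x]
      fun z => kaehler e (conjDiff f 0 z) := by
    filter_upwards [hU.mem_nhds hxU] with y hy
    have hW := (hf.areaDensity_pos (hUV hy)).ne'
    rw [Fin.sum_univ_two, hf.pderiv_angle_eq (hUV hy) hU hy hβ,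
      hf.pderiv_angle_eq (hUV hy) hU hy hβ, metric_inv_one_zero, metric_inv_one_one,
      ← hf.areaDensity_sq (hUV hy), kaehler_conjDiff]
    field_simp
    ring
  rw [laplaceBeltrami, Fin.sum_univ_two, pderiv_congr e0, pderiv_congr e1, pderiv_neg] at h
  have := (mul_eq_zero.1 h).resolve_left (inv_ne_zero (hf.areaDensity_pos hx).ne')
  linarith

/-- The gradients of `⟨e, f⟩` and `⟨J e, f⟩` are orthogonal. -/
lemma conj_parallel : kaehler e (conjDiff f 0 x) * inner ℝ e (pderiv 1 f x) =
    kaehler e (conjDiff f 1 x) * inner ℝ e (pderiv 0 f x) := by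
  have h1 := hf.laplacian_im hx
  have h2 : ∀ k l, pderiv l (fun z => kaehler e (conjDiff f k z)) x =
      kaehler e (pderiv l (conjDiff f k) x) := fun k l =>
    hf.pderiv_inner_conjDiff hx (Complex.I • e) l k
  -- Harmonicity of v is ⟨Je, Δf⟩ = 0, and Δf is a multiple of e^⊥; `kaehler_normalPart_self`
  -- rewrites ⟨Je, e^⊥⟩ through the components of *dv and du.
  rw [h2, h2, ← sub_eq_zero, ← kaehler_sub_right, hf.laplacian_eq_meanCurvature hx,
    hf.translating x hx, kaehler_smul_right, hf.kaehler_normalPart_self hx] at h1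
  linarith

/-- The orthogonal projection is not differentiated directly: `inner_normalPart` writes this
function as a quotient of smooth expressions in the first derivatives of f. -/
lemma contDiffAt_normSq : ContDiffAt ℝ ∞ (fun z => (inner ℝ e (normalPart f z e) : ℝ)) x := by
  have h : (fun z => (inner ℝ e (normalPart f z e) : ℝ)) =ᶠ[nhds x]
      fun z => (kaehler e (conjDiff f 1 z) * kaehler e (pderiv 0 f z) -
        kaehler e (conjDiff f 0 z) * kaehler e (pderiv 1 f z)) / areaDensity f z := by
    filter_upwards [hf.mem_nhds hx] with y hy
    rw [← hf.inner_normalPart hy, mul_div_cancel_left₀ _ (hf.areaDensity_pos hy).ne']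
  refine ContDiffAt.congr_of_eventuallyEq ?_ h
  exact (((hf.contDiffAt_inner_conjDiff hx _ 1).mul (hf.contDiffAt_inner_pderiv hx _ 0)).sub
    ((hf.contDiffAt_inner_conjDiff hx _ 0).mul (hf.contDiffAt_inner_pderiv hx _ 1))).div
    (hf.contDiffAt_areaDensity hx) (hf.areaDensity_pos hx).ne'

omit hf hx in
/-- The conjugate harmonic function of `⟨J e, f⟩`. -/
noncomputable def conjHeight (f : R2 → C2) (e : C2) (z : R2) : ℝ :=
  (inner ℝ e (pderiv 1 f z) * kaehler e (pderiv 0 f z) -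
    inner ℝ e (pderiv 0 f z) * kaehler e (pderiv 1 f z)) /
      (areaDensity f z * inner ℝ e (normalPart f z e))

/-! ### Points where e is not tangent: s as harmonic conjugate of v. -/

section Regular

variable (hn : (inner ℝ e (normalPart f x e) : ℝ) ≠ 0)
include hn

lemma eventually_regular : ∀ᶠ y in nhds x, y ∈ V ∧ (inner ℝ e (normalPart f y e) : ℝ) ≠ 0 :=
  Filter.Eventually.and (hf.mem_nhds hx) ((hf.contDiffAt_normSq hx).continuousAt.eventually_ne hn)

lemma contDiffAt_conjHeight : ContDiffAt ℝ ∞ (conjHeight f e) x :=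
  (((hf.contDiffAt_inner_pderiv hx e 1).mul (hf.contDiffAt_inner_pderiv hx (Complex.I • e) 0)).sub
    ((hf.contDiffAt_inner_pderiv hx e 0).mul
      (hf.contDiffAt_inner_pderiv hx (Complex.I • e) 1))).div
    ((hf.contDiffAt_areaDensity hx).mul (hf.contDiffAt_normSq hx))
    (mul_ne_zero (hf.areaDensity_pos hx).ne' hn)

/-- The relation du = s *dv. By `conj_parallel` du and *dv are proportional, and `conjHeight` is
their ratio, obtained by wedging both with dv; the denominator *dv ∧ dv is |e^⊥|² dA, nonzero here.
-/
lemma inner_pderiv_eq (k : Fin 2) : (inner ℝ e (pderiv k f x) : ℝ) =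
    conjHeight f e x * kaehler e (conjDiff f k x) := by
  have hW := (hf.areaDensity_pos hx).ne'
  have h1 := hf.inner_normalPart hx e
  have h2 := hf.conj_parallel hx
  rw [conjHeight, div_mul_eq_mul_div, eq_div_iff (mul_ne_zero hW hn), h1]
  fin_cases k
  · simp only [Fin.zero_eta]
    linear_combination (-kaehler e (pderiv 0 f x)) * h2
  · simp only [Fin.mk_one]
    linear_combination (-kaehler e (pderiv 1 f x)) * h2

/-- The Hodge star applied to du = s *dv, with ** = -1 on one-forms. -/
lemma inner_conjDiff_eq (k : Fin 2) : (inner ℝ e (conjDiff f k x) : ℝ) =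
    - (conjHeight f e x * kaehler e (pderiv k f x)) := by
  have hW := (hf.areaDensity_pos hx).ne'
  have hD := hf.metric_mul_sub hx
  rw [inner_conjDiff, hf.inner_pderiv_eq hx hn 0, hf.inner_pderiv_eq hx hn 1, kaehler_conjDiff,
    kaehler_conjDiff]
  have hc := metric_comm f x
  fin_cases k
  · simp only [Fin.zero_eta, hc]
    field_simp
    linear_combination (-kaehler e (pderiv 0 f x)) * conjHeight f e x * hD
  · simp only [Fin.mk_one, hc]
    field_simp
    linear_combination (-kaehler e (pderiv 1 f x)) * conjHeight f e x * hD

/-- By the two relations between du and dv, the tangential part of e has squared length s²|e^⊥|², so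
Pythagoras gives the claim. -/
lemma normSq_mul : inner ℝ e (normalPart f x e) * (1 + conjHeight f e x ^ 2) =
    (inner ℝ e e : ℝ) := by
  have hW := (hf.areaDensity_pos hx).ne'
  have h1 := hf.inner_self_eq hx e
  have h2 := hf.inner_normalPart hx e
  rw [hf.inner_conjDiff_eq hx hn, hf.inner_conjDiff_eq hx hn, hf.inner_pderiv_eq hx hn,
    hf.inner_pderiv_eq hx hn] at h1
  refine mul_left_cancel₀ hW ?_
  linear_combination conjHeight f e x ^ 2 * h2 - h1

/-- `ds = *dv`. -/
lemma pderiv_conjHeight (k : Fin 2) : pderiv k (conjHeight f e) x = kaehler e (conjDiff f k x) := by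
  have hW := (hf.areaDensity_pos hx).ne'
  have ds := ContDiffAt.diff (hf.contDiffAt_conjHeight hx hn)
  have hreg := hf.eventually_regular hx hn
  have dP := fun k => ContDiffAt.diff (hf.contDiffAt_inner_conjDiff hx (Complex.I • e) k)
  have dv := fun k => ContDiffAt.diff (hf.contDiffAt_inner_pderiv hx (Complex.I • e) k)
  -- The relations du = s *dv and *du = -s dv hold near the point, so both may be differentiated.
  have a : ∀ k l, (inner ℝ e (pderiv l (pderiv k f) x) : ℝ) =
      conjHeight f e x * pderiv l (fun z => kaehler e (conjDiff f k z)) x +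
        kaehler e (conjDiff f k x) * pderiv l (conjHeight f e) x := by
    intro k l
    rw [← pderiv_const_inner e (ContDiffAt.diff (hf.contDiffAt_pderiv hx k))]
    rw [pderiv_congr (g := fun z => conjHeight f e z * kaehler e (conjDiff f k z))]
    · exact pderiv_mul ds (dP k) l
    · filter_upwards [hreg] with y hy using hf.inner_pderiv_eq hy.1 hy.2 k
  have b : ∀ k l, pderiv l (fun z => (inner ℝ e (conjDiff f k z) : ℝ)) x =
      - (conjHeight f e x * kaehler e (pderiv l (pderiv k f) x) +
        kaehler e (pderiv k f x) * pderiv l (conjHeight f e) x) := by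
    intro k l
    rw [pderiv_congr (g := fun z => - (conjHeight f e z * kaehler e (pderiv k f z)))]
    · rw [pderiv_neg, kaehler,
        ← pderiv_const_inner (Complex.I • e) (ContDiffAt.diff (hf.contDiffAt_pderiv hx k))]
      exact congrArg _ (pderiv_mul ds (dv k) l)
    · filter_upwards [hreg] with y hy using hf.inner_conjDiff_eq hy.1 hy.2 k
  have h1 := a 0 1
  have h2 := a 1 0
  have h3 := hf.laplacian_re hx
  rw [b, b, pderiv_comm (hf.contDiffAt x hx) 1 0] at h3
  rw [pderiv_comm (hf.contDiffAt x hx) 1 0] at h1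
  have h4 := hf.laplacian_im hx
  have h5 := hf.inner_normalPart hx e
  have hne := mul_ne_zero hW hn
  -- Symmetry of second derivatives of u together with d*dv = 0 leaves ds ∧ *dv = 0. Thus ds is a
  -- multiple of *dv, and `h3`, the equation for d*du, fixes the factor to be 1.
  have h6 : kaehler e (conjDiff f 0 x) * pderiv 1 (conjHeight f e) x =
      kaehler e (conjDiff f 1 x) * pderiv 0 (conjHeight f e) x := by
    linear_combination h2 - h1 + conjHeight f e x * h4
  refine mul_left_cancel₀ hne ?_
  fin_cases k
  · simp only [Fin.zero_eta]
    linear_combination pderiv 0 (conjHeight f e) x * h5 + kaehler e (conjDiff f 0 x) * h3 -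
      kaehler e (pderiv 0 f x) * h6
  · simp only [Fin.mk_one]
    linear_combination pderiv 1 (conjHeight f e) x * h5 + kaehler e (conjDiff f 1 x) * h3 -
      kaehler e (pderiv 1 f x) * h6

end Regular

end IsSolitonPatch

/-! ### Unique continuation for the tangency of e. -/

lemma norm_fderiv_le_pderiv (g : R2 → ℝ) (x : R2) :
    ‖fderiv ℝ g x‖ ≤ |pderiv 0 g x| + |pderiv 1 g x| := by
  refine ContinuousLinearMap.opNorm_le_bound _ (by positivity) fun y => ?_
  rw [fderiv_eq_pderiv, smul_eq_mul, smul_eq_mul]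
  have h0 := PiLp.norm_apply_le y 0
  have h1 := PiLp.norm_apply_le y 1
  rw [Real.norm_eq_abs] at h0 h1
  calc ‖y 0 * pderiv 0 g x + y 1 * pderiv 1 g x‖
      ≤ |y 0| * |pderiv 0 g x| + |y 1| * |pderiv 1 g x| := by
        rw [← abs_mul, ← abs_mul]; exact abs_add_le _ _
    _ ≤ ‖y‖ * |pderiv 0 g x| + ‖y‖ * |pderiv 1 g x| := by gcongr
    _ = _ := by ring

/-- A function whose differential is dominated by its values, and which vanishes at the centre of
a ball, vanishes on the ball. -/
lemma eq_zero_of_norm_fderiv_le {E : Type*} [NormedAddCommGroup E] [NormedSpace ℝ E] {g : E → ℝ}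
    {x : E} {r C : ℝ} (hg : ∀ y ∈ Metric.ball x r, DifferentiableAt ℝ g y)
    (hC : ∀ y ∈ Metric.ball x r, ‖fderiv ℝ g y‖ ≤ C * ‖g y‖) (h0 : g x = 0) {y : E}
    (hy : y ∈ Metric.ball x r) : g y = 0 := by
  have hmem : ∀ t ∈ Set.Icc (0 : ℝ) 1, x + t • (y - x) ∈ Metric.ball x r := by
    intro t ht
    have := (convex_ball x r).add_smul_sub_mem (Metric.mem_ball_self (dist_nonneg.trans_lt hy)) hy ht
    exact this
  have hd : ∀ t ∈ Set.Icc (0 : ℝ) 1, HasDerivAt (fun t : ℝ => g (x + t • (y - x)))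
      (fderiv ℝ g (x + t • (y - x)) (y - x)) t := by
    intro t ht
    have hγ : HasDerivAt (fun t : ℝ => x + t • (y - x)) (y - x) t := by
      simpa using ((hasDerivAt_id t).smul_const (y - x)).const_add x
    exact (hg _ (hmem t ht)).hasFDerivAt.comp_hasDerivAt t hγ
  have := norm_le_gronwallBound_of_norm_deriv_right_le (f := fun t : ℝ => g (x + t • (y - x)))
    (δ := 0) (K := C * ‖y - x‖) (ε := 0) (a := 0) (b := 1)
    (fun t ht => (hd t ht).continuousAt.continuousWithinAt)
    (fun t ht => (hd t ⟨ht.1, ht.2.le⟩).hasDerivWithinAt) (by simp [h0])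
    (fun t ht => by
      have h1 := hC _ (hmem t ⟨ht.1, ht.2.le⟩)
      calc ‖fderiv ℝ g (x + t • (y - x)) (y - x)‖
          ≤ ‖fderiv ℝ g (x + t • (y - x))‖ * ‖y - x‖ := ContinuousLinearMap.le_opNorm _ _
        _ ≤ C * ‖g (x + t • (y - x))‖ * ‖y - x‖ := by gcongr
        _ = _ := by ring) 1 (by simp)
  simpa [gronwallBound_ε0_δ0] using this

namespace IsSolitonPatch

variable {f : R2 → C2} {V : Set R2} {e : C2} (hf : IsSolitonPatch f V e)
include hf

/-- Where N = |e^⊥|² is nonzero, N = |e|²/(1 + s²) and ds = *dv give dN = -(2s/(1 + s²)) N *dv, and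
|2s| ≤ 1 + s². Where N vanishes it has a minimum, so dN = 0. The bound does not involve s, which is
undefined geometrically at the zeros. -/
lemma abs_pderiv_normSq_le {x : R2} (hx : x ∈ V) (k : Fin 2) :
    |pderiv k (fun z => (inner ℝ e (normalPart f z e) : ℝ)) x| ≤
      |kaehler e (conjDiff f k x)| * |(inner ℝ e (normalPart f x e) : ℝ)| := by
  by_cases hn : (inner ℝ e (normalPart f x e) : ℝ) = 0
  · have hmin : IsLocalMin (fun z => (inner ℝ e (normalPart f z e) : ℝ)) x := by
      refine Filter.Eventually.of_forall fun z => ?_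
      simp only [hn]
      rw [← inner_normalPart_self]
      exact real_inner_self_nonneg
    rw [pderiv, hmin.fderiv_eq_zero]
    simp [hn]
  · have hs : 0 < 1 + conjHeight f e x ^ 2 := by positivity
    have hd : HasDerivAt (fun t : ℝ => inner ℝ e e / (1 + t ^ 2))
        (-(inner ℝ e e * (2 * conjHeight f e x)) / (1 + conjHeight f e x ^ 2) ^ 2)
        (conjHeight f e x) := by
      have h1 : HasDerivAt (fun t : ℝ => 1 + t ^ 2) (2 * conjHeight f e x) (conjHeight f e x) := by
        simpa using (hasDerivAt_pow 2 (conjHeight f e x)).const_add 1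
      have h2 := (hasDerivAt_const (conjHeight f e x) (inner ℝ e e : ℝ)).fun_div h1 hs.ne'
      rw [zero_mul, zero_sub] at h2
      exact h2
    have hloc : (fun z => (inner ℝ e (normalPart f z e) : ℝ)) =ᶠ[nhds x]
        fun z => inner ℝ e e / (1 + conjHeight f e z ^ 2) := by
      filter_upwards [hf.eventually_regular hx hn] with y hy
      rw [← hf.normSq_mul hy.1 hy.2, mul_div_cancel_right₀]
      positivity
    rw [pderiv_congr hloc, pderiv_comp hd (ContDiffAt.diff (hf.contDiffAt_conjHeight hx hn)),
      hf.pderiv_conjHeight hx hn, ← hf.normSq_mul hx hn, smul_eq_mul, abs_mul]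
    refine mul_le_mul_of_nonneg_left ?_ (abs_nonneg _)
    have : -(inner ℝ e (normalPart f x e) * (1 + conjHeight f e x ^ 2) * (2 * conjHeight f e x)) /
        (1 + conjHeight f e x ^ 2) ^ 2 = inner ℝ e (normalPart f x e) *
          (-(2 * conjHeight f e x) / (1 + conjHeight f e x ^ 2)) := by
      field_simp
    rw [this, abs_mul]
    refine mul_le_of_le_one_right (abs_nonneg _) ?_
    rw [abs_div, abs_of_pos hs, div_le_one hs, abs_le]
    constructor <;> nlinarith [sq_nonneg (conjHeight f e x - 1), sq_nonneg (conjHeight f e x + 1)]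

/-- The components of *dv are bounded near the point by continuity, so `abs_pderiv_normSq_le` is a
linear differential inequality and Grönwall applies along segments. -/
lemma eventually_normSq_eq_zero {x : R2} (hx : x ∈ V)
    (hn : (inner ℝ e (normalPart f x e) : ℝ) = 0) :
    ∀ᶠ y in nhds x, (inner ℝ e (normalPart f y e) : ℝ) = 0 := by
  have hP : ∀ k, ∀ᶠ y in nhds x, |kaehler e (conjDiff f k y)| <
      |kaehler e (conjDiff f k x)| + 1 := by
    intro k
    exact (hf.contDiffAt_inner_conjDiff hx (Complex.I • e) k).continuousAt.abs.eventually_lt_const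
      (lt_add_one _)
  obtain ⟨r, hr, hB⟩ := Metric.eventually_nhds_iff_ball.1
    (((hP 0).and (hP 1)).and (show ∀ᶠ y in nhds x, y ∈ V from hf.mem_nhds hx))
  filter_upwards [Metric.ball_mem_nhds x hr] with y hy
  refine eq_zero_of_norm_fderiv_le
    (C := |kaehler e (conjDiff f 0 x)| + 1 + (|kaehler e (conjDiff f 1 x)| + 1))
    (fun z hz => ContDiffAt.diff (hf.contDiffAt_normSq (hB z hz).2)) (fun z hz => ?_) hn hy
  refine (norm_fderiv_le_pderiv _ z).trans ?_
  rw [add_mul, Real.norm_eq_abs]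
  have h0 := hf.abs_pderiv_normSq_le (hB z hz).2 0
  have h1 := hf.abs_pderiv_normSq_le (hB z hz).2 1
  gcongr
  · exact h0.trans (mul_le_mul_of_nonneg_right (hB z hz).1.1.le (abs_nonneg _))
  · exact h1.trans (mul_le_mul_of_nonneg_right (hB z hz).1.2.le (abs_nonneg _))

/-- If the translating vector is tangent everywhere, the surface is totally geodesic. -/
lemma secondFundamentalForm_eq_zero (he : e ≠ 0)
    (hn : ∀ x ∈ V, (inner ℝ e (normalPart f x e) : ℝ) = 0) {x : R2} (hx : x ∈ V) (i j : Fin 2) :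
    secondFundamentalForm f x i j = 0 := by
  have hn0 : ∀ y ∈ V, normalPart f y e = 0 := by
    intro y hy
    have := hn y hy
    rw [← inner_normalPart_self] at this
    exact inner_self_eq_zero.1 this
  have hv : ∀ y ∈ V, ∀ k, kaehler e (pderiv k f y) = 0 := by
    intro y hy k
    rw [kaehler_swap, ← hf.kaehler_normalPart hy, hn0 y hy]
    simp [kaehler]
  have hvv : ∀ k l, kaehler e (pderiv k (pderiv l f) x) = 0 := by
    intro k l
    rw [kaehler, ← pderiv_const_inner _ (ContDiffAt.diff (hf.contDiffAt_pderiv hx l)),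
      pderiv_congr (g := fun _ => 0), pderiv_const]
    filter_upwards [hf.mem_nhds hx] with y hy using hv y hy l
  have hH := hf.kaehler_meanCurvature hx
  rw [hf.translating x hx, hn0 x hx] at hH
  obtain ⟨X, hX⟩ := sub_normalPart_mem f x e
  rw [hn0 x hx, sub_zero, fderiv_eq_pderiv] at hX
  have hee : (0 : ℝ) < inner ℝ e e := real_inner_self_pos.2 he
  have hq : (inner ℝ e e : ℝ) = metric f x 0 0 * X 0 ^ 2 + 2 * metric f x 0 1 * (X 0 * X 1) +
      metric f x 1 1 * X 1 ^ 2 := by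
    rw [hX]
    simp only [inner_add_left, inner_add_right, real_inner_smul_left, real_inner_smul_right,
      metric_apply, real_inner_comm (pderiv 0 f x) (pderiv 1 f x)]
    ring
  have hdet := hf.det_pos hx
  rw [metric_det] at hdet
  have hE : metric f x 0 0 ≠ 0 := by
    intro h; rw [h] at hdet; nlinarith [sq_nonneg (metric f x 0 1)]
  have hG : metric f x 1 1 ≠ 0 := by
    intro h; rw [h] at hdet; nlinarith [sq_nonneg (metric f x 0 1)]
  have s1 := hf.cubic_symm hx 0 0 1
  have s2 := hf.cubic_symm hx 1 0 1
  have s3 := pderiv_comm (hf.contDiffAt x hx) 1 0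
  rw [s3] at s2
  have hz : ∀ k, kaehler (pderiv k f x) 0 = 0 := fun k => by simp [kaehler]
  have t0 := hH 0
  have t1 := hH 1
  simp only [hz, zero_mul, s1, s2] at t0 t1
  have x00 := hvv 0 0
  have x01 := hvv 0 1
  have x11 := hvv 1 1
  rw [hX, kaehler_add_left, kaehler_smul_left, kaehler_smul_left] at x00 x01 x11
  rw [s1] at x00
  rw [s2] at x01
  -- By symmetry the cubic form C has four components. `t0` and `t1` say that it is trace free (H =
  -- 0), and `x00`, `x01`, `x11` that C(e, ·, ·) = 0, since ω(e, df) vanishes identically. In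
  -- dimension two these force C = 0; this component is isolated by multiplying with |e|² expanded
  -- in the coordinates X of e.
  have c2 : kaehler (pderiv 0 f x) (pderiv 1 (pderiv 1 f) x) = 0 := by
    have : (inner ℝ e e : ℝ) * kaehler (pderiv 0 f x) (pderiv 1 (pderiv 1 f) x) = 0 := by
      rw [hq]
      linear_combination (-X 0 ^ 2) * t0 - metric f x 1 1 * X 0 * x00 +
        metric f x 1 1 * X 1 * x01 + 2 * metric f x 0 1 * X 0 * x01
    exact (mul_eq_zero.1 this).resolve_left hee.ne'
  rw [c2] at t0 t1 x01 x11
  have c1 : kaehler (pderiv 0 f x) (pderiv 0 (pderiv 1 f) x) = 0 := by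
    by_cases h0 : X 0 = 0
    · have h1 : X 1 ≠ 0 := by
        intro h1
        rw [hq, h0, h1] at hee
        simp at hee
      have c3 : kaehler (pderiv 1 f x) (pderiv 1 (pderiv 1 f) x) = 0 := by simpa [h1] using x11
      rw [c3] at t1
      simpa [hG] using t1
    · simpa [h0] using x01
  rw [c1] at t0 t1
  have c0 : kaehler (pderiv 0 f x) (pderiv 0 (pderiv 0 f) x) = 0 := by simpa [hG] using t0
  have c3 : kaehler (pderiv 1 f x) (pderiv 1 (pderiv 1 f) x) = 0 := by simpa [hE] using t1
  have hc : ∀ k, kaehler (pderiv k f x) (pderiv i (pderiv j f) x) = 0 := by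
    intro k
    fin_cases k <;> fin_cases i <;> fin_cases j <;> simp [s1, s2, s3, c0, c1, c2, c3]
  refine hf.ext_of_inner hx (fun k => ?_) fun k => ?_
  · rw [secondFundamentalForm, inner_normalPart_pderiv, inner_zero_left]
  · rw [secondFundamentalForm, kaehler_swap, hf.kaehler_normalPart hx, hc]
    simp [kaehler]

end IsSolitonPatch

/-! ### The local normal form -/

/-- The parametrization `(s, v) ↦ (s² / 2 + i v + b, K s e^{-iv} + w)`. -/
noncomputable def model (K w : ℂ) (b : ℝ) (x : R2) : C2 :=
  !₂[((x 0 ^ 2 / 2 + b : ℝ) : ℂ) + Complex.I * x 1,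
    K * x 0 * Complex.exp (Complex.I * ((-x 1 : ℝ) : ℂ)) + w]

/-- The complex linear similarity `p ↦ (⟨e, p⟩, det (e, p))`. -/
noncomputable def heightMap (e p : C2) : C2 :=
  !₂[(starRingEnd ℂ) (e 0) * p 0 + (starRingEnd ℂ) (e 1) * p 1, cdet e p]

lemma heightMap_zero (e p : C2) :
    heightMap e p 0 = (inner ℝ e p : ℝ) + Complex.I * (kaehler e p : ℝ) := by
  apply Complex.ext
  · simp [heightMap, inner_coord]; ring
  · simp [heightMap, kaehler, inner_coord]; ring

namespace IsSolitonPatch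

variable {f : R2 → C2} {V : Set R2} {e : C2} (hf : IsSolitonPatch f V e)
include hf

/-- The conformal coordinates `(s, v)` in which the surface takes its normal form. -/
lemma map_nhds_conformal {x : R2} (hx : x ∈ V) (hn : (inner ℝ e (normalPart f x e) : ℝ) ≠ 0) :
    Filter.map (fun y => (!₂[conjHeight f e y, kaehler e (f y)] : R2)) (nhds x) =
      nhds !₂[conjHeight f e x, kaehler e (f x)] := by
  set h : R2 → R2 := fun y => !₂[conjHeight f e y, kaehler e (f y)] with hh
  have hs : ContDiffAt ℝ ∞ h x := by
    rw [contDiffAt_euclidean]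
    intro i
    fin_cases i
    · exact hf.contDiffAt_conjHeight hx hn
    · exact hf.contDiffAt_height hx (Complex.I • e)
  have hc : ∀ k i, pderiv k h x i = pderiv k (fun y => h y i) x := fun k i =>
    (pderiv_clm (EuclideanSpace.proj i : R2 →L[ℝ] ℝ) (ContDiffAt.diff hs) k).symm
  have h0 : ∀ k, pderiv k h x 0 = kaehler e (conjDiff f k x) := fun k =>
    (hc k 0).trans (hf.pderiv_conjHeight hx hn k)
  have h1 : ∀ k, pderiv k h x 1 = kaehler e (pderiv k f x) := fun k =>
    (hc k 1).trans (hf.pderiv_height hx (Complex.I • e) k)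
  have hW := (hf.areaDensity_pos hx).ne'
  have hJ := hf.inner_normalPart hx e
  have hne := mul_ne_zero hW hn
  rw [hJ] at hne
  -- The Jacobian determinant of (s, v) is that of *dv ∧ dv, the area density times |e^⊥|², hence
  -- nonzero. The preimage below comes from Cramer's rule.
  refine (hs.hasStrictFDerivAt (by simp)).map_nhds_eq_of_surj (LinearMap.range_eq_top.2 ?_)
  intro z
  set J := kaehler e (conjDiff f 1 x) * kaehler e (pderiv 0 f x) -
      kaehler e (conjDiff f 0 x) * kaehler e (pderiv 1 f x) with hJdef
  refine ⟨!₂[(z 1 * kaehler e (conjDiff f 1 x) - z 0 * kaehler e (pderiv 1 f x)) / J,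
    (z 0 * kaehler e (pderiv 0 f x) - z 1 * kaehler e (conjDiff f 0 x)) / J], ?_⟩
  rw [ContinuousLinearMap.coe_coe, fderiv_eq_pderiv]
  ext i
  fin_cases i
  · simp [h0]
    field_simp
    rw [hJdef]; ring
  · simp [h1]
    field_simp
    rw [hJdef]; ring

/-- Where `e` is not tangent, a Hamiltonian stationary translating soliton is locally
parametrized by the model. -/
theorem exists_normal_form {x : R2} (hx : x ∈ V)
    (hn : (inner ℝ e (normalPart f x e) : ℝ) ≠ 0) :
    ∃ (K w : ℂ) (b : ℝ) (h : R2 → R2), ‖K‖ = 1 ∧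
      ∀ᶠ y in nhds x, heightMap e (f y) = model K w b (h y) ∧
        Filter.map h (nhds y) = nhds (h y) := by
  obtain ⟨U, hU, hxU, hUV, β, hβ, -⟩ := hf.stationary x hx
  have hreg := hf.eventually_regular hx hn
  have dv : ∀ y ∈ V, DifferentiableAt ℝ (fun z => kaehler e (f z)) y := fun y hy =>
    ContDiffAt.diff (hf.contDiffAt_height hy (Complex.I • e))
  have pv : ∀ y ∈ V, ∀ k, pderiv k (fun z => kaehler e (f z)) y = kaehler e (pderiv k f y) :=
    fun y hy k => hf.pderiv_height hy (Complex.I • e) k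
  have du : ∀ y ∈ V, DifferentiableAt ℝ (fun z => (inner ℝ e (f z) : ℝ)) y := fun y hy =>
    ContDiffAt.diff (hf.contDiffAt_height hy e)
  have ds : ∀ y ∈ V, (inner ℝ e (normalPart f y e) : ℝ) ≠ 0 →
      DifferentiableAt ℝ (conjHeight f e) y := fun y hy hny =>
    ContDiffAt.diff (hf.contDiffAt_conjHeight hy hny)
  have dβ : ∀ y ∈ U, DifferentiableAt ℝ β y := fun y hy =>
    ContDiffAt.diff (hβ.1.contDiffAt (hU.mem_nhds hy))
  -- Constancy of u - s²/2, because du = s *dv = s ds.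
  have hb := eventually_eq_of_pderiv_eq_zero
    (f := fun z => (inner ℝ e (f z) : ℝ) - 1 / 2 * (conjHeight f e z * conjHeight f e z)) (x := x)
    (hreg.mono fun y hy => (du y hy.1).fun_sub
      (((ds y hy.1 hy.2).fun_mul (ds y hy.1 hy.2)).const_mul _))
    (hreg.mono fun y hy k => by
      have d := ds y hy.1 hy.2
      rw [pderiv_sub (du y hy.1) ((d.fun_mul d).const_mul _),
        pderiv_mul (differentiableAt_const _) (d.fun_mul d), pderiv_mul d d, pderiv_const,
        hf.pderiv_height hy.1, hf.inner_pderiv_eq hy.1 hy.2, hf.pderiv_conjHeight hy.1 hy.2]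
      ring)
  have hUx : ∀ᶠ y in nhds x, y ∈ U := hU.mem_nhds hxU
  have hθ := eventually_eq_of_pderiv_eq_zero (f := fun z => β z + kaehler e (f z)) (x := x)
    (hUx.mono fun y hy => (dβ y hy).fun_add (dv y (hUV hy)))
    (hUx.mono fun y hy k => by
      rw [pderiv_add (dβ y hy) (dv y (hUV hy)), hf.pderiv_angle_eq (hUV hy) hU hy hβ,
        pv y (hUV hy)]
      ring)
  set θ := β x + kaehler e (f x) with hθdef
  -- From `cdet_pderiv`, d det(e, f) = (-s dv - i ds) e^{iβ}. With β = θ - v this is -i e^{iθ} (ds -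
  -- i s dv) e^{-iv}, that is K d(s e^{-iv}).
  set K := -Complex.I * Complex.exp (Complex.I * (θ : ℂ)) with hK
  have dE : ∀ y ∈ V, DifferentiableAt ℝ
      (fun z => Complex.exp (Complex.I * ((-kaehler e (f z) : ℝ) : ℂ))) y := fun y hy =>
    differentiableAt_exp_I_mul (dv y hy).fun_neg
  have dw : ∀ y ∈ V, DifferentiableAt ℝ (fun z => cdet e (f z)) y := by
    intro y hy
    have := differentiableAt_coord (ContDiffAt.diff (hf.contDiffAt y hy))
    exact ((this 1).const_mul _).fun_sub ((this 0).const_mul _)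
  have hw := eventually_eq_of_pderiv_eq_zero
    (f := fun z => cdet e (f z) - K * ((conjHeight f e z : ℂ) *
      Complex.exp (Complex.I * ((-kaehler e (f z) : ℝ) : ℂ)))) (x := x)
    (hreg.mono fun y hy => (dw y hy.1).fun_sub
      (((differentiableAt_ofReal (ds y hy.1 hy.2)).fun_mul (dE y hy.1)).const_mul _))
    (by
      filter_upwards [hreg, hθ, hUx] with y hy hyθ hyU k
      have d := differentiableAt_ofReal (ds y hy.1 hy.2)
      rw [pderiv_sub (dw y hy.1) ((d.fun_mul (dE y hy.1)).const_mul _),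
        pderiv_mul (differentiableAt_const _) (d.fun_mul (dE y hy.1)), pderiv_mul d (dE y hy.1),
        pderiv_const, pderiv_exp_I_mul (dv y hy.1).fun_neg, pderiv_neg, pv y hy.1,
        pderiv_ofReal (ds y hy.1 hy.2), hf.pderiv_conjHeight hy.1 hy.2,
        pderiv_cdet (differentiableAt_const e) (ContDiffAt.diff (hf.contDiffAt y hy.1)),
        pderiv_const]
      have hW : (areaDensity f y : ℂ) ≠ 0 :=
        Complex.ofReal_ne_zero.2 (hf.areaDensity_pos hy.1).ne'
      have h1 := hf.cdet_pderiv hy.1 e k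
      rw [hβ.2 y hyU, hf.inner_conjDiff_eq hy.1 hy.2] at h1
      have h2 : cdet e (pderiv k f y) = ((-(conjHeight f e y * kaehler e (pderiv k f y)) : ℝ) -
          Complex.I * kaehler e (conjDiff f k y)) * Complex.exp (Complex.I * (β y : ℂ)) := by
        refine mul_left_cancel₀ hW (h1.trans ?_)
        ring
      have h3 : Complex.exp (Complex.I * (β y : ℂ)) = Complex.exp (Complex.I * (θ : ℂ)) *
          Complex.exp (Complex.I * ((-kaehler e (f y) : ℝ) : ℂ)) := by
        rw [← Complex.exp_add, ← hyθ]
        congr 1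
        push_cast
        ring
      have h4 : cdet 0 (f y) = 0 := by simp [cdet]
      rw [h2, h3, h4, hK]
      push_cast
      linear_combination (Complex.exp (Complex.I * (θ : ℂ)) *
          Complex.exp (Complex.I * (-(kaehler e (f y) : ℂ))) * conjHeight f e y *
          kaehler e (pderiv k f y)) * (-Complex.I_sq))
  generalize (inner ℝ e (f x) : ℝ) - 1 / 2 * (conjHeight f e x * conjHeight f e x) = b at hb
  generalize cdet e (f x) - K * _ = w at hw
  refine ⟨K, w, b, fun y => !₂[conjHeight f e y, kaehler e (f y)], ?_, ?_⟩
  · rw [hK, norm_mul, Complex.norm_exp]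
    simp
  · filter_upwards [hb, hw, hreg] with y hyb hyw hy
    refine ⟨?_, hf.map_nhds_conformal hy.1 hy.2⟩
    rw [sub_eq_iff_eq_add] at hyb hyw
    ext i
    fin_cases i
    · simp only [Fin.zero_eta, heightMap_zero, model, hyb]
      simp
      ring
    · simp only [Fin.mk_one, heightMap, model, PiLp.toLp_apply, Matrix.cons_val_one,
        Matrix.cons_val_zero, Matrix.cons_val_fin_one, hyw]
      ring

end IsSolitonPatch

/-! ### The model surface -/

lemma model_zero (K w : ℂ) (b : ℝ) (x : R2) :
    model K w b x 0 = ((x 0 ^ 2 / 2 + b : ℝ) : ℂ) + Complex.I * x 1 := rfl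

lemma model_one (K w : ℂ) (b : ℝ) (x : R2) :
    model K w b x 1 = K * x 0 * Complex.exp (Complex.I * ((-x 1 : ℝ) : ℂ)) + w := rfl

lemma model_zero_re (K w : ℂ) (b : ℝ) (x : R2) : (model K w b x 0).re = x 0 ^ 2 / 2 + b := by
  rw [model_zero, Complex.add_re, Complex.ofReal_re]; simp

lemma model_zero_im (K w : ℂ) (b : ℝ) (x : R2) : (model K w b x 0).im = x 1 := by
  rw [model_zero, Complex.add_im, Complex.ofReal_im]; simp

lemma C2_ext {p q : C2} (h0 : p 0 = q 0) (h1 : p 1 = q 1) : p = q := by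
  ext i; fin_cases i
  · exact h0
  · exact h1

lemma continuous_model (K w : ℂ) (b : ℝ) : Continuous (model K w b) := by
  unfold model
  fun_prop

lemma exp_I_mul_mul_exp_neg (t : ℝ) :
    Complex.exp (Complex.I * (t : ℂ)) * Complex.exp (Complex.I * ((-t : ℝ) : ℂ)) = 1 := by
  rw [← Complex.exp_add, ← mul_add]; simp

/-- A continuous left inverse exists on all of ℂ²: v is the imaginary part of the first coordinate,
and s is recovered by undoing the factor K e^{-iv} in the second. -/
lemma isEmbedding_model {K : ℂ} (hK : K ≠ 0) (w : ℂ) (b : ℝ) :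
    Topology.IsEmbedding (model K w b) := by
  refine Topology.IsEmbedding.of_leftInverse (f := fun p : C2 =>
    (!₂[((p 1 - w) / K * Complex.exp (Complex.I * ((p 0).im : ℂ))).re, (p 0).im] : R2)) ?_ ?_
    (continuous_model K w b)
  · intro x
    have h0 := model_zero_im K w b x
    have h1 : (model K w b x 1 - w) / K * Complex.exp (Complex.I * (x 1 : ℂ)) = x 0 := by
      rw [model_one, add_sub_cancel_right, mul_assoc, mul_div_cancel_left₀ _ hK, mul_assoc,
        mul_comm (Complex.exp _), exp_I_mul_mul_exp_neg, mul_one]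
    ext i
    fin_cases i
    · simp [h0, h1]
    · simp [h0]
  · fun_prop

lemma range_model_eq_surfaceM : Set.range (model 1 0 0) = surfaceM := by
  ext p
  constructor
  · rintro ⟨x, rfl⟩
    have hre : (model 1 0 0 x 0).re = x 0 ^ 2 / 2 := by rw [model_zero_re, add_zero]
    have him := model_zero_im 1 0 0 x
    refine ⟨?_, by rw [hre]; positivity⟩
    rw [hre, him, model_one, one_mul, add_zero, mul_pow, ← Complex.exp_nat_mul]
    push_cast
    rw [show (2 : ℂ) * (Complex.I * -(x 1 : ℂ)) = -2 * Complex.I * (x 1 : ℂ) by ring]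
    ring
  · rintro ⟨h1, h2⟩
    set E := Complex.exp (Complex.I * ((p 0).im : ℂ)) with hE
    set E' := Complex.exp (Complex.I * ((-(p 0).im : ℝ) : ℂ)) with hE'
    have hEE : E * E' = 1 := exp_I_mul_mul_exp_neg _
    have hE2 : Complex.exp (-2 * Complex.I * ((p 0).im : ℂ)) = E' ^ 2 := by
      rw [hE', ← Complex.exp_nat_mul]
      push_cast
      congr 1
      ring
    -- Removing the phase from w leaves a number whose square is real and nonnegative, hence a real
    -- number; it is the parameter s.
    have hsq : (p 1 * E) ^ 2 = ((2 * (p 0).re : ℝ) : ℂ) := by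
      rw [mul_pow, h1, hE2]
      push_cast
      linear_combination 2 * ((p 0).re : ℂ) * (E * E' + 1) * hEE
    have hfac : (p 1 * E - (√(2 * (p 0).re) : ℝ)) * (p 1 * E + (√(2 * (p 0).re) : ℝ)) = 0 := by
      have : ((√(2 * (p 0).re) : ℝ) : ℂ) ^ 2 = ((2 * (p 0).re : ℝ) : ℂ) := by
        rw [← Complex.ofReal_pow, Real.sq_sqrt (by positivity)]
      linear_combination hsq - this
    obtain ⟨s, hs, hs2⟩ : ∃ s : ℝ, p 1 * E = s ∧ s ^ 2 = 2 * (p 0).re := by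
      rcases mul_eq_zero.1 hfac with h | h
      · exact ⟨√(2 * (p 0).re), sub_eq_zero.1 h, Real.sq_sqrt (by positivity)⟩
      · refine ⟨-√(2 * (p 0).re), ?_, by rw [neg_sq, Real.sq_sqrt (by positivity)]⟩
        push_cast
        exact eq_neg_of_add_eq_zero_left h
    refine ⟨!₂[s, (p 0).im], C2_ext ?_ ?_⟩
    · apply Complex.ext
      · simp [model_zero_re, hs2]
      · simp [model_zero_im]
    · rw [model_one]
      simp only [Matrix.cons_val_zero, Matrix.cons_val_one,
        Matrix.cons_val_fin_one]
      rw [← hE', ← hs]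
      linear_combination (p 1) * hEE

lemma model_eq (K w : ℂ) (b : ℝ) (x : R2) :
    model K w b x = !₂[model 1 0 0 x 0 + b, K * model 1 0 0 x 1 + w] := by
  refine C2_ext ?_ ?_
  · simp [model_zero]; ring
  · simp [model_one]; ring

lemma range_model (K w : ℂ) (b : ℝ) :
    Set.range (model K w b) = (fun p : C2 => (!₂[p 0 + b, K * p 1 + w] : C2)) '' surfaceM := by
  rw [← range_model_eq_surfaceM, ← Set.range_comp]
  congr 1
  ext1 x
  exact model_eq K w b x

/-- The parameter v is common to both models, as the imaginary part of the first coordinate; the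
parameter s of the second model enters the two coordinates through s and s², so squaring eliminates
it. -/
lemma sq_eq_of_mem_range {K w K' w' : ℂ} {b b' : ℝ} {x : R2}
    (h : model K w b x ∈ Set.range (model K' w' b')) :
    (K * x 0 + (w - w') * Complex.exp (Complex.I * (x 1 : ℂ))) ^ 2 =
      K' ^ 2 * ((x 0 ^ 2 + 2 * (b - b') : ℝ) : ℂ) := by
  obtain ⟨y, hy⟩ := h
  have h0 := congrArg (fun p : C2 => p 0) hy
  have h1 := congrArg (fun p : C2 => p 1) hy
  have him := congrArg Complex.im h0
  have hre := congrArg Complex.re h0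
  simp only [model_one, model_zero_im, model_zero_re] at h1 him hre
  rw [him] at h1
  have hE := exp_I_mul_mul_exp_neg (x 1)
  have h2 : K * x 0 + (w - w') * Complex.exp (Complex.I * (x 1 : ℂ)) = K' * y 0 := by
    linear_combination (K' * y 0 - K * x 0) * hE - Complex.exp (Complex.I * (x 1 : ℂ)) * h1
  rw [h2, show x 0 ^ 2 + 2 * (b - b') = y 0 ^ 2 by linarith]
  push_cast
  ring

/-- Two model surfaces which agree near a point coincide. -/
lemma range_model_eq_of_eventually {K w K' w' : ℂ} {b b' : ℝ} (hK : K ≠ 0) (hK' : K' ≠ 0)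
    {x : R2} (h : ∀ᶠ y in nhds x, model K w b y ∈ Set.range (model K' w' b')) :
    Set.range (model K w b) = Set.range (model K' w' b') := by
  -- The bound ε < 1 < π serves to distinguish the phases at v and v + ε.
  obtain ⟨ε, hε, hε', hB⟩ : ∃ ε : ℝ, 0 < ε ∧ ε < 1 ∧ ∀ s t : ℝ, |s| ≤ ε → |t| ≤ ε →
      (K * (x 0 + s : ℝ) + (w - w') * Complex.exp (Complex.I * ((x 1 + t : ℝ) : ℂ))) ^ 2 =
      K' ^ 2 * (((x 0 + s) ^ 2 + 2 * (b - b') : ℝ) : ℂ) := by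
    have hc : Filter.Tendsto (fun q : ℝ × ℝ => (!₂[x 0 + q.1, x 1 + q.2] : R2)) (nhds 0)
        (nhds x) := by
      have : Continuous (fun q : ℝ × ℝ => (!₂[x 0 + q.1, x 1 + q.2] : R2)) := by fun_prop
      have h2 := this.tendsto 0
      have h3 : (!₂[x 0 + (0 : ℝ × ℝ).1, x 1 + (0 : ℝ × ℝ).2] : R2) = x := by
        ext i; fin_cases i <;> simp
      rwa [h3] at h2
    obtain ⟨r, hr, hB⟩ := Metric.eventually_nhds_iff_ball.1 (hc.eventually h)
    refine ⟨min (r / 2) (1 / 2), by positivity, by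
      have := min_le_right (r / 2) (1 / 2 : ℝ); linarith, fun s t hs ht => ?_⟩
    have hm := min_le_left (r / 2) (1 / 2 : ℝ)
    have := hB (s, t) (by
      rw [Metric.mem_ball, dist_zero_right, Prod.norm_def, max_lt_iff, Real.norm_eq_abs,
        Real.norm_eq_abs]
      constructor <;> simp only <;> linarith)
    simpa using sq_eq_of_mem_range this
  -- The sign of s is chosen to move away from 0, so that the square strictly increases.
  obtain ⟨s, hs, hs0, hs2⟩ : ∃ s : ℝ, |s| ≤ ε ∧ s ≠ 0 ∧ (x 0 + s) ^ 2 ≠ x 0 ^ 2 := by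
    rcases le_total 0 (x 0) with h0 | h0
    · exact ⟨ε, by rw [abs_of_pos hε], hε.ne', by nlinarith⟩
    · exact ⟨-ε, by rw [abs_neg, abs_of_pos hε], by linarith, by nlinarith⟩
  have hεa : |ε| ≤ ε := (abs_of_pos hε).le
  have h0a : |(0 : ℝ)| ≤ ε := by simpa using hε.le
  have hE : Complex.exp (Complex.I * ((x 1 + 0 : ℝ) : ℂ)) ≠
      Complex.exp (Complex.I * ((x 1 + ε : ℝ) : ℂ)) := by
    intro hE
    have h1 : Complex.exp (Complex.I * (ε : ℂ)) = 1 := by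
      have := exp_I_mul_mul_exp_neg (x 1)
      rw [add_zero] at hE
      rw [← this, hE, ← Complex.exp_add]
      congr 1
      push_cast
      ring
    have h2 := congrArg Complex.im h1
    rw [mul_comm, Complex.exp_ofReal_mul_I_im, Complex.one_im] at h2
    exact (Real.sin_pos_of_pos_of_lt_pi hε (by linarith [Real.pi_gt_three])).ne' h2
  -- The right side of `hB` does not depend on v. If w ≠ w', subtracting its values at two phases
  -- gives a relation affine in s with leading coefficient 2K ≠ 0, which cannot hold for two values
  -- of s.
  have hw : w - w' = 0 := by
    by_contra hδ
    have key : ∀ s : ℝ, |s| ≤ ε → 2 * (K * (x 0 + s : ℝ)) + (w - w') *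
        (Complex.exp (Complex.I * ((x 1 + 0 : ℝ) : ℂ)) +
          Complex.exp (Complex.I * ((x 1 + ε : ℝ) : ℂ))) = 0 := by
      intro s hs
      have h1 := hB s 0 hs h0a
      have h2 := hB s ε hs hεa
      have hne := mul_ne_zero hδ (sub_ne_zero.2 hE)
      refine (mul_eq_zero.1 ?_).resolve_left hne
      linear_combination h1 - h2
    have h1 := key s hs
    have h2 := key 0 h0a
    have h3 : K * (s : ℂ) = 0 := by
      push_cast at h1 h2
      linear_combination (h1 - h2) / 2
    rcases mul_eq_zero.1 h3 with h | h
    · exact hK h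
    · exact hs0 (by exact_mod_cast h)
  have h1 := hB s 0 hs h0a
  have h2 := hB 0 0 h0a h0a
  rw [hw] at h1 h2
  have hKK : K ^ 2 = K' ^ 2 := by
    have hne : (((x 0 + s) ^ 2 - x 0 ^ 2 : ℝ) : ℂ) ≠ 0 :=
      Complex.ofReal_ne_zero.2 (sub_ne_zero.2 hs2)
    refine mul_right_cancel₀ hne ?_
    push_cast at h1 h2 ⊢
    linear_combination h1 - h2
  have hb : b = b' := by
    have h3 : K' ^ 2 * ((b - b' : ℝ) : ℂ) = 0 := by
      push_cast at h2 ⊢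
      linear_combination (x 0 ^ 2 * hKK - h2) / 2
    have := (mul_eq_zero.1 h3).resolve_left (pow_ne_zero 2 hK')
    exact sub_eq_zero.1 (by exact_mod_cast this)
  have hw' := sub_eq_zero.1 hw
  subst hb hw'
  -- The sign ambiguity of K is absorbed by the reparametrization s ↦ -s.
  rcases sq_eq_sq_iff_eq_or_eq_neg.1 hKK with h | h
  · rw [h]
  · have hneg : ∀ y : R2, model K w b y = model K' w b !₂[-y 0, y 1] := by
      intro y
      refine C2_ext ?_ ?_
      · simp [model_zero]
      · simp [model_one, h]
    have hneg' : ∀ y : R2, model K' w b y = model K w b !₂[-y 0, y 1] := by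
      intro y
      refine C2_ext ?_ ?_
      · simp [model_zero]
      · simp [model_one, h]
    apply Set.Subset.antisymm
    · rintro _ ⟨y, rfl⟩
      exact ⟨_, (hneg y).symm⟩
    · rintro _ ⟨y, rfl⟩
      exact ⟨_, (hneg' y).symm⟩

/-! ### The similarity defined by the translating vector -/

lemma continuous_heightMap (e : C2) : Continuous (heightMap e) := by
  unfold heightMap cdet
  fun_prop

lemma inner_self_complex (e : C2) : ((inner ℝ e e : ℝ) : ℂ) =
    (starRingEnd ℂ) (e 0) * e 0 + (starRingEnd ℂ) (e 1) * e 1 := by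
  rw [inner_coord, ← Complex.normSq_eq_conj_mul_self, ← Complex.normSq_eq_conj_mul_self,
    Complex.normSq_apply, Complex.normSq_apply]
  push_cast
  ring

lemma heightMap_injective {e : C2} (he : e ≠ 0) : Function.Injective (heightMap e) := by
  intro p q h
  have hee : ((inner ℝ e e : ℝ) : ℂ) ≠ 0 :=
    Complex.ofReal_ne_zero.2 (real_inner_self_pos.2 he).ne'
  have h0 := congrArg (fun x : C2 => x 0) h
  have h1 := congrArg (fun x : C2 => x 1) h
  simp [heightMap, cdet] at h0 h1
  have hi := inner_self_complex e
  refine C2_ext (mul_left_cancel₀ hee ?_) (mul_left_cancel₀ hee ?_)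
  · rw [hi]
    linear_combination e 0 * h0 - (starRingEnd ℂ) (e 1) * h1
  · rw [hi]
    linear_combination e 1 * h0 + (starRingEnd ℂ) (e 0) * h1

/-- `heightMap e` is ‖e‖ times a unitary map. Its inverse, after rotating the second coordinate by
K, has columns e and K(-ē₁, ē₀) up to scale; the translation is the preimage of (b, w). -/
lemma exists_similarity {e : C2} (he : e ≠ 0) {K : ℂ} (hK : ‖K‖ = 1) (w : ℂ) (b : ℝ) :
    ∃ (r : ℝ) (U : C2 ≃ₗᵢ[ℂ] C2) (v : C2), 0 < r ∧
      ∀ p : C2, heightMap e (r • U p + v) = !₂[p 0 + b, K * p 1 + w] := by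
  have hc : 0 < ‖e‖ := norm_pos_iff.2 he
  have hc' : (‖e‖ : ℂ) ≠ 0 := Complex.ofReal_ne_zero.2 hc.ne'
  have hi : ((‖e‖ : ℝ) : ℂ) ^ 2 = (starRingEnd ℂ) (e 0) * e 0 + (starRingEnd ℂ) (e 1) * e 1 := by
    rw [← inner_self_complex, real_inner_self_eq_norm_sq]
    push_cast
    rfl
  let A : C2 →ₗ[ℂ] C2 :=
    { toFun := fun p => !₂[(‖e‖ : ℂ)⁻¹ * (e 0 * p 0 - (starRingEnd ℂ) (e 1) * K * p 1),
        (‖e‖ : ℂ)⁻¹ * (e 1 * p 0 + (starRingEnd ℂ) (e 0) * K * p 1)]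
      map_add' := fun p q => by
        refine C2_ext ?_ ?_
        · simp; ring
        · simp; ring
      map_smul' := fun c p => by
        refine C2_ext ?_ ?_
        · simp; ring
        · simp; ring }
  have hA0 : ∀ p, A p 0 = (‖e‖ : ℂ)⁻¹ * (e 0 * p 0 - (starRingEnd ℂ) (e 1) * K * p 1) :=
    fun _ => rfl
  have hA1 : ∀ p, A p 1 = (‖e‖ : ℂ)⁻¹ * (e 1 * p 0 + (starRingEnd ℂ) (e 0) * K * p 1) :=
    fun _ => rfl
  have hKK : (starRingEnd ℂ) K * K = 1 := by
    rw [mul_comm, Complex.mul_conj, Complex.normSq_eq_norm_sq, hK]; simp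
  have hnorm : ∀ p, ‖A p‖ = ‖p‖ := by
    intro p
    rw [← sq_eq_sq₀ (norm_nonneg _) (norm_nonneg _), ← real_inner_self_eq_norm_sq,
      ← real_inner_self_eq_norm_sq, ← Complex.ofReal_inj, inner_self_complex, inner_self_complex,
      hA0, hA1]
    simp only [map_mul, map_sub, map_add, map_inv₀, Complex.conj_ofReal, Complex.conj_conj]
    field_simp
    rw [hi]
    linear_combination ((starRingEnd ℂ) (e 0) * e 0 + (starRingEnd ℂ) (e 1) * e 1) *
      ((starRingEnd ℂ) (p 1) * p 1) * hKK
  let U : C2 ≃ₗᵢ[ℂ] C2 := (⟨A, hnorm⟩ : C2 →ₗᵢ[ℂ] C2).toLinearIsometryEquiv rfl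
  have hU : ∀ p, U p = A p := fun p => rfl
  refine ⟨‖e‖⁻¹, U, !₂[((‖e‖ : ℂ) ^ 2)⁻¹ * (e 0 * b - (starRingEnd ℂ) (e 1) * w),
    ((‖e‖ : ℂ) ^ 2)⁻¹ * (e 1 * b + (starRingEnd ℂ) (e 0) * w)], inv_pos.2 hc, fun p => ?_⟩
  refine C2_ext ?_ ?_
  · simp [heightMap, hU, hA0, hA1]
    field_simp
    linear_combination (-(p 0 + b)) * hi
  · simp [heightMap, cdet, hU, hA0, hA1]
    field_simp
    linear_combination (-(K * p 1 + w)) * hi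

/-- Restates the vanishing of |e^⊥|² as membership in the image of the differential, which can be
compared between charts. -/
lemma inner_normalPart_eq_zero_iff (f : R2 → C2) (x : R2) (e : C2) :
    (inner ℝ e (normalPart f x e) : ℝ) = 0 ↔ e ∈ Set.range (fderiv ℝ f x) := by
  constructor
  · intro h
    rw [← inner_normalPart_self, inner_self_eq_zero] at h
    obtain ⟨y, hy⟩ := sub_normalPart_mem f x e
    exact ⟨y, by rw [← hy, h, sub_zero]⟩
  · rintro ⟨y, hy⟩
    rw [normalPart_eq_of (n := 0) (h := y) (by simp) (by rw [hy, sub_zero]), inner_zero_right]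

/-! ### From charts to a connected surface. -/

section Manifold

variable {M : Type*} [TopologicalSpace M] [ChartedSpace R2 M] [IsManifold (𝓡 2) ∞ M]

lemma fderiv_comp_chart {φ : M → C2} (hφ : ContMDiff (𝓡 2) 𝓘(ℝ, C2) ∞ φ)
    {c : OpenPartialHomeomorph M R2} (hc : c ∈ atlas R2 M) {x : R2} (hx : x ∈ c.target) :
    ∃ T : R2 ≃ R2, ∀ y, fderiv ℝ (φ ∘ c.symm) x y =
      mfderiv (𝓡 2) 𝓘(ℝ, C2) φ (c.symm x) (T y) := by
  have : IsManifold (𝓡 2) 1 M := IsManifold.of_le (n := ∞) (by simp)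
  have hcd : c.MDifferentiable (𝓡 2) (𝓡 2) := mdifferentiable_of_mem_atlas hc
  have hb : Function.Bijective (mfderiv (𝓡 2) (𝓡 2) c.symm x) := hcd.symm.mfderiv_bijective hx
  refine ⟨Equiv.ofBijective _ hb, fun y => ?_⟩
  have h1 : MDifferentiableAt (𝓡 2) 𝓘(ℝ, C2) φ (c.symm x) :=
    (hφ (c.symm x)).mdifferentiableAt (by simp)
  have h2 : MDifferentiableAt (𝓡 2) (𝓡 2) c.symm x := hcd.mdifferentiableAt_symm hx
  have h3 := mfderiv_comp x h1 h2
  rw [mfderiv_eq_fderiv] at h3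
  rw [h3]
  rfl

lemma contDiffAt_comp_chart {φ : M → C2} (hφ : ContMDiff (𝓡 2) 𝓘(ℝ, C2) ∞ φ)
    {c : OpenPartialHomeomorph M R2} (hc : c ∈ atlas R2 M) {x : R2} (hx : x ∈ c.target) :
    ContDiffAt ℝ ∞ (φ ∘ c.symm) x := by
  have h1 := contMDiffOn_symm_of_mem_maximalAtlas
    (IsManifold.subset_maximalAtlas (I := 𝓡 2) (n := ∞) hc)
  have h2 : ContMDiffOn (𝓡 2) 𝓘(ℝ, C2) ∞ (φ ∘ c.symm) c.target := hφ.comp_contMDiffOn h1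
  exact (contMDiffOn_iff_contDiffOn.1 h2).contDiffAt (c.open_target.mem_nhds hx)

variable {φ : M → C2} {e : C2} (hφ : IsHSLTranslatingSoliton φ e)
include hφ

lemma IsHSLTranslatingSoliton.isSolitonPatch {c : OpenPartialHomeomorph M R2}
    (hc : c ∈ atlas R2 M) : IsSolitonPatch (φ ∘ c.symm) c.target e where
  isOpen := c.open_target
  contDiffAt x hx := contDiffAt_comp_chart hφ.immersion.1 hc hx
  injective x hx := by
    obtain ⟨T, hT⟩ := fderiv_comp_chart hφ.immersion.1 hc hx
    intro y z hyz
    rw [hT, hT] at hyz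
    exact T.injective (hφ.immersion.2 _ hyz)
  lagrangian x hx := hφ.lagrangian c hc x hx
  translating x hx := hφ.translating.2 c hc x hx
  stationary x hx := hφ.hamiltonianStationary c hc x hx

lemma IsHSLTranslatingSoliton.tangent_iff {c : OpenPartialHomeomorph M R2}
    (hc : c ∈ atlas R2 M) {p : M} (hp : p ∈ c.source) :
    (inner ℝ e (normalPart (φ ∘ c.symm) (c p) e) : ℝ) = 0 ↔
      e ∈ Set.range (mfderiv (𝓡 2) 𝓘(ℝ, C2) φ p) := by
  rw [inner_normalPart_eq_zero_iff]
  obtain ⟨T, hT⟩ := fderiv_comp_chart hφ.immersion.1 hc (c.map_source hp)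
  rw [c.left_inv hp] at hT
  constructor
  · rintro ⟨y, rfl⟩
    exact ⟨T y, (hT y).symm⟩
  · rintro ⟨y, hy⟩
    obtain ⟨z, rfl⟩ := T.surjective y
    exact ⟨z, (hT z).trans hy⟩

/-- On a connected surface which is not totally geodesic, the translating vector is nowhere
tangent. -/
lemma IsHSLTranslatingSoliton.normSq_ne_zero [PreconnectedSpace M] (hg : ¬ IsTotallyGeodesic φ)
    {c : OpenPartialHomeomorph M R2} (hc : c ∈ atlas R2 M) {x : R2} (hx : x ∈ c.target) :
    (inner ℝ e (normalPart (φ ∘ c.symm) x e) : ℝ) ≠ 0 := by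
  -- The tangency set is described through `mfderiv`, so it makes sense without a chart. It is open
  -- by Grönwall and closed by continuity of |e^⊥|².
  let Z : Set M := {p | e ∈ Set.range (mfderiv (𝓡 2) 𝓘(ℝ, C2) φ p)}
  have hZo : IsOpen Z := by
    rw [isOpen_iff_mem_nhds]
    intro p hp
    have hs := mem_chart_source R2 p
    have hat := chart_mem_atlas R2 p
    have h0 := (hφ.isSolitonPatch hat).eventually_normSq_eq_zero ((chartAt R2 p).map_source hs)
      ((hφ.tangent_iff hat hs).2 hp)
    filter_upwards [((chartAt R2 p).continuousAt hs).eventually h0,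
      (chartAt R2 p).open_source.mem_nhds hs] with q hq hqs
    exact (hφ.tangent_iff hat hqs).1 hq
  have hZc : IsClosed Z := by
    rw [← isOpen_compl_iff, isOpen_iff_mem_nhds]
    intro p hp
    have hs := mem_chart_source R2 p
    have hat := chart_mem_atlas R2 p
    have h0 := (hφ.isSolitonPatch hat).eventually_regular ((chartAt R2 p).map_source hs)
      (fun h => hp ((hφ.tangent_iff hat hs).1 h))
    filter_upwards [((chartAt R2 p).continuousAt hs).eventually h0,
      (chartAt R2 p).open_source.mem_nhds hs] with q hq hqs
    exact fun h => hq.2 ((hφ.tangent_iff hat hqs).2 h)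
  rcases isClopen_iff.1 (⟨hZc, hZo⟩ : IsClopen Z) with h | h
  · intro h0
    have hx' := c.map_target hx
    rw [← c.right_inv hx, hφ.tangent_iff hc hx'] at h0
    exact (h ▸ (h0 : c.symm x ∈ Z) : c.symm x ∈ (∅ : Set M))
  · refine absurd (fun c' hc' y hy i j => ?_) hg
    refine (hφ.isSolitonPatch hc').secondFundamentalForm_eq_zero hφ.translating.1
      (fun z hz => ?_) hy i j
    rw [← c'.right_inv hz, hφ.tangent_iff hc' (c'.map_target hz)]
    have hz' : c'.symm z ∈ Z := h ▸ Set.mem_univ _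
    exact hz'

lemma IsHSLTranslatingSoliton.exists_normal_form [PreconnectedSpace M]
    (hg : ¬ IsTotallyGeodesic φ) (p : M) :
    ∃ (K w : ℂ) (b : ℝ) (h : M → R2), ‖K‖ = 1 ∧
      ∀ᶠ q in nhds p, heightMap e (φ q) = model K w b (h q) ∧
        Filter.map h (nhds q) = nhds (h q) := by
  have hs := mem_chart_source R2 p
  have hat := chart_mem_atlas R2 p
  have ht := (chartAt R2 p).map_source hs
  obtain ⟨K, w, b, h, hK, hh⟩ := (hφ.isSolitonPatch hat).exists_normal_form ht
    (hφ.normSq_ne_zero hg hat ht)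
  refine ⟨K, w, b, h ∘ chartAt R2 p, hK, ?_⟩
  filter_upwards [((chartAt R2 p).continuousAt hs).eventually hh,
    (chartAt R2 p).open_source.mem_nhds hs] with q hq hqs
  refine ⟨?_, ?_⟩
  · have := hq.1
    rwa [Function.comp_apply, (chartAt R2 p).left_inv hqs] at this
  · rw [← Filter.map_map, (chartAt R2 p).map_nhds_eq hqs, hq.2]
    rfl

/-- The image is a relatively open subset of one model surface. -/
lemma IsHSLTranslatingSoliton.exists_model [ConnectedSpace M] (hg : ¬ IsTotallyGeodesic φ) :
    ∃ (K w : ℂ) (b : ℝ) (O : Set C2), ‖K‖ = 1 ∧ IsOpen O ∧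
      Set.range φ = O ∩ heightMap e ⁻¹' Set.range (model K w b) := by
  have hne : ∀ {K : ℂ}, ‖K‖ = 1 → K ≠ 0 := by
    rintro K hK rfl
    simp at hK
  obtain ⟨p₀⟩ := (inferInstance : Nonempty M)
  obtain ⟨K, w, b, h₀, hK, hh₀⟩ := hφ.exists_normal_form hg p₀
  -- The local constants K, w, b might vary from point to point. A collects the points near which
  -- those of p₀ work; it is open by definition, and `hrig` makes it closed.
  let A : Set M := {p | ∀ᶠ q in nhds p, heightMap e (φ q) ∈ Set.range (model K w b)}
  -- Near a point of the closure, the local model there and the fixed model both contain the image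
  -- of a neighbourhood of some point of A. Since h maps neighbourhoods onto neighbourhoods, they
  -- share an open piece and so coincide.
  have hrig : ∀ {p : M} {K' w' : ℂ} {b' : ℝ} {h : M → R2}, ‖K'‖ = 1 →
      (∀ᶠ q in nhds p, heightMap e (φ q) = model K' w' b' (h q) ∧
        Filter.map h (nhds q) = nhds (h q)) → p ∈ closure A →
      Set.range (model K' w' b') = Set.range (model K w b) := by
    intro p K' w' b' h hK' hh hp
    obtain ⟨q, hq, hqA⟩ := mem_closure_iff_nhds.1 hp _ (hh.eventually_nhds)
    refine range_model_eq_of_eventually (hne hK') (hne hK) (x := h q) ?_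
    rw [← hq.self_of_nhds.2, Filter.eventually_map]
    filter_upwards [hq, hqA] with z hz hzA
    rw [← hz.1]
    exact hzA
  have hAo : IsOpen A := isOpen_setOfPred_eventually_nhds
  have hAc : IsClosed A := by
    refine isClosed_of_closure_subset fun p hp => ?_
    obtain ⟨K', w', b', h, hK', hh⟩ := hφ.exists_normal_form hg p
    have := hrig hK' hh hp
    filter_upwards [hh] with q hq
    rw [← this, hq.1]
    exact ⟨_, rfl⟩
  have hA : A = Set.univ := IsClopen.eq_univ ⟨hAc, hAo⟩
    ⟨p₀, hh₀.mono fun q hq => hq.1 ▸ ⟨_, rfl⟩⟩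
  have hmem : ∀ p, heightMap e (φ p) ∈ Set.range (model K w b) := fun p =>
    (hA ▸ Set.mem_univ p : p ∈ A).self_of_nhds
  have hloc : ∀ p, ∃ O : Set C2, IsOpen O ∧ φ p ∈ O ∧
      O ∩ heightMap e ⁻¹' Set.range (model K w b) ⊆ Set.range φ := by
    intro p
    obtain ⟨K', w', b', h, hK', hh⟩ := hφ.exists_normal_form hg p
    have hS := hrig hK' hh (by rw [hA]; simp)
    -- The coordinates h fill a neighbourhood in the parameter plane, and the model is an embedding.
    -- So every point of the model close enough to the image of φ p is attained by φ.
    have himg : h '' {q | heightMap e (φ q) = model K' w' b' (h q)} ∈ nhds (h p) := by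
      rw [← hh.self_of_nhds.2]
      exact Filter.image_mem_map (hh.mono fun q hq => hq.1)
    rw [(isEmbedding_model (hne hK') w' b').nhds_eq_comap, Filter.mem_comap] at himg
    obtain ⟨t, ht, hts⟩ := himg
    rw [← hh.self_of_nhds.1] at ht
    obtain ⟨O, hOs, hO, hpO⟩ := mem_nhds_iff.1
      ((continuous_heightMap e).continuousAt.preimage_mem_nhds ht)
    refine ⟨O, hO, hpO, ?_⟩
    rintro y ⟨hyO, hy⟩
    rw [← hS] at hy
    obtain ⟨z, hz⟩ := hy
    have hzt : z ∈ model K' w' b' ⁻¹' t := by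
      rw [Set.mem_preimage, hz]
      exact hOs hyO
    obtain ⟨q, hq, rfl⟩ := hts hzt
    exact ⟨q, heightMap_injective hφ.translating.1 (hq.trans hz)⟩
  choose O hO hpO hOφ using hloc
  refine ⟨K, w, b, ⋃ p, O p, hK, isOpen_iUnion hO, Set.Subset.antisymm ?_ ?_⟩
  · rintro _ ⟨p, rfl⟩
    exact ⟨Set.mem_iUnion.2 ⟨p, hpO p⟩, hmem p⟩
  · rintro y ⟨hy, hyS⟩
    obtain ⟨p, hp⟩ := Set.mem_iUnion.1 hy
    exact hOφ p ⟨hp, hyS⟩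

/-- The image is, up to a complex similarity, a relatively open subset of `surfaceM`. -/
theorem IsHSLTranslatingSoliton.range_eq [ConnectedSpace M] (hg : ¬ IsTotallyGeodesic φ) :
    ∃ (r : ℝ) (U : C2 ≃ₗᵢ[ℂ] C2) (v : C2) (O : Set C2), 0 < r ∧ IsOpen O ∧
      Set.range φ = O ∩ ((fun p => r • U p + v) '' surfaceM) := by
  obtain ⟨K, w, b, O, hK, hO, hrange⟩ := hφ.exists_model hg
  obtain ⟨r, U, v, hr, hU⟩ := exists_similarity hφ.translating.1 hK w b
  refine ⟨r, U, v, O, hr, hO, ?_⟩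
  rw [hrange, range_model]
  congr 1
  ext y
  constructor
  · rintro ⟨p, hp, hpy⟩
    exact ⟨p, hp, heightMap_injective hφ.translating.1 ((hU p).trans hpy)⟩
  · rintro ⟨p, hp, rfl⟩
    exact ⟨p, hp, (hU p).symm⟩

end Manifold

/-! ### The surface `surfaceM` as an example -/

/-- The unitary factor `e^{-iv}`. -/
noncomputable def phase (x : R2) : ℂ := Complex.exp (Complex.I * ((-x 1 : ℝ) : ℂ))

lemma phase_re_sq_add_im_sq (x : R2) : (phase x).re ^ 2 + (phase x).im ^ 2 = 1 := by
  have h := conj_exp_mul (-x 1)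
  rw [← Complex.normSq_eq_conj_mul_self, Complex.ofReal_eq_one, Complex.normSq_apply] at h
  rw [phase]
  linarith

lemma contDiff_coord (i : Fin 2) : ContDiff ℝ ∞ (fun y : R2 => y i) :=
  (EuclideanSpace.proj i : R2 →L[ℝ] ℝ).contDiff

lemma differentiableAt_coord_self (i : Fin 2) (x : R2) :
    DifferentiableAt ℝ (fun y : R2 => y i) x :=
  ContDiffAt.diff (contDiff_coord i).contDiffAt

lemma pderiv_coord_self (k i : Fin 2) (x : R2) :
    pderiv k (fun y : R2 => y i) x = if i = k then 1 else 0 := by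
  have : HasFDerivAt (fun y : R2 => y i) (EuclideanSpace.proj i : R2 →L[ℝ] ℝ) x :=
    (EuclideanSpace.proj i : R2 →L[ℝ] ℝ).hasFDerivAt
  rw [pderiv, this.fderiv]
  simp

lemma differentiableAt_phase (x : R2) : DifferentiableAt ℝ phase x :=
  differentiableAt_exp_I_mul (differentiableAt_coord_self 1 x).fun_neg

lemma pderiv_zero_phase (x : R2) : pderiv 0 phase x = 0 := by
  unfold phase
  rw [pderiv_exp_I_mul (differentiableAt_coord_self 1 x).fun_neg, pderiv_neg, pderiv_coord_self]
  simp

lemma pderiv_one_phase (x : R2) : pderiv 1 phase x = -Complex.I * phase x := by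
  unfold phase
  rw [pderiv_exp_I_mul (differentiableAt_coord_self 1 x).fun_neg, pderiv_neg, pderiv_coord_self]
  simp

lemma contDiff_toLp {g h : R2 → ℂ} (hg : ContDiff ℝ ∞ g) (hh : ContDiff ℝ ∞ h) :
    ContDiff ℝ ∞ (fun x => (!₂[g x, h x] : C2)) := by
  rw [contDiff_piLp]
  intro i
  fin_cases i
  · exact hg
  · exact hh

lemma differentiableAt_toLp {g h : R2 → ℂ} {x : R2} (hg : DifferentiableAt ℝ g x)
    (hh : DifferentiableAt ℝ h x) :
    DifferentiableAt ℝ (fun x => (!₂[g x, h x] : C2)) x := by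
  rw [differentiableAt_piLp]
  intro i
  fin_cases i
  · exact hg
  · exact hh

lemma pderiv_toLp {g h : R2 → ℂ} {x : R2} (hg : DifferentiableAt ℝ g x)
    (hh : DifferentiableAt ℝ h x) (k : Fin 2) :
    pderiv k (fun x => (!₂[g x, h x] : C2)) x = !₂[pderiv k g x, pderiv k h x] := by
  have hd := differentiableAt_toLp hg hh
  refine C2_ext ?_ ?_
  · rw [← pderiv_coord hd]; rfl
  · rw [← pderiv_coord hd]; rfl

lemma contDiff_model (K w : ℂ) (b : ℝ) : ContDiff ℝ ∞ (model K w b) := by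
  have h0 := contDiff_coord 0
  have h1 := contDiff_coord 1
  have hof : ContDiff ℝ ∞ (fun t : ℝ => (t : ℂ)) := Complex.ofRealCLM.contDiff
  refine contDiff_toLp ?_ ?_
  · exact (hof.comp (((h0.pow 2).div_const 2).add contDiff_const)).add
      (contDiff_const.mul (hof.comp h1))
  · exact ((contDiff_const.mul (hof.comp h0)).mul
      (contDiff_const.mul (hof.comp h1.neg)).cexp).add contDiff_const

lemma model_one_zero_zero :
    model 1 0 0 = fun x => !₂[(1 / 2 : ℂ) * ((x 0 : ℂ) * x 0) + Complex.I * x 1,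
      (x 0 : ℂ) * phase x] := by
  ext1 x
  refine C2_ext ?_ ?_
  · rw [model_zero]; simp; ring
  · rw [model_one, phase]; simp

lemma pderiv_zero_model : pderiv 0 (model 1 0 0) = fun x => !₂[(x 0 : ℂ), phase x] := by
  ext1 x
  have d0 := differentiableAt_ofReal (differentiableAt_coord_self 0 x)
  have d1 := differentiableAt_ofReal (differentiableAt_coord_self 1 x)
  have dp := differentiableAt_phase x
  rw [model_one_zero_zero, pderiv_toLp (((d0.fun_mul d0).const_mul _).fun_add (d1.const_mul _))
    (d0.fun_mul dp), pderiv_add ((d0.fun_mul d0).const_mul _) (d1.const_mul _),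
    pderiv_mul (differentiableAt_const _) (d0.fun_mul d0), pderiv_mul d0 d0,
    pderiv_mul (differentiableAt_const _) d1, pderiv_mul d0 dp, pderiv_zero_phase,
    pderiv_ofReal (differentiableAt_coord_self 0 x),
    pderiv_ofReal (differentiableAt_coord_self 1 x), pderiv_coord_self, pderiv_coord_self,
    pderiv_const, pderiv_const]
  refine C2_ext ?_ ?_
  · simp; ring
  · simp

lemma pderiv_one_model :
    pderiv 1 (model 1 0 0) = fun x => !₂[Complex.I, (x 0 : ℂ) * (-Complex.I * phase x)] := by
  ext1 x
  have d0 := differentiableAt_ofReal (differentiableAt_coord_self 0 x)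
  have d1 := differentiableAt_ofReal (differentiableAt_coord_self 1 x)
  have dp := differentiableAt_phase x
  rw [model_one_zero_zero, pderiv_toLp (((d0.fun_mul d0).const_mul _).fun_add (d1.const_mul _))
    (d0.fun_mul dp), pderiv_add ((d0.fun_mul d0).const_mul _) (d1.const_mul _),
    pderiv_mul (differentiableAt_const _) (d0.fun_mul d0), pderiv_mul d0 d0,
    pderiv_mul (differentiableAt_const _) d1, pderiv_mul d0 dp, pderiv_one_phase,
    pderiv_ofReal (differentiableAt_coord_self 0 x),
    pderiv_ofReal (differentiableAt_coord_self 1 x), pderiv_coord_self, pderiv_coord_self,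
    pderiv_const, pderiv_const]
  refine C2_ext ?_ ?_
  · simp
  · simp

lemma pderiv_zero_zero_model (x : R2) : pderiv 0 (pderiv 0 (model 1 0 0)) x = !₂[1, 0] := by
  rw [pderiv_zero_model, pderiv_toLp (differentiableAt_ofReal (differentiableAt_coord_self 0 x))
    (differentiableAt_phase x), pderiv_zero_phase,
    pderiv_ofReal (differentiableAt_coord_self 0 x), pderiv_coord_self]
  simp

lemma pderiv_one_one_model (x : R2) :
    pderiv 1 (pderiv 1 (model 1 0 0)) x = !₂[0, -((x 0 : ℂ) * phase x)] := by
  have d0 := differentiableAt_ofReal (differentiableAt_coord_self 0 x)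
  have dp := differentiableAt_phase x
  rw [pderiv_one_model, pderiv_toLp (differentiableAt_const _) (d0.fun_mul (dp.const_mul _)),
    pderiv_const, pderiv_mul d0 (dp.const_mul _), pderiv_mul (differentiableAt_const _) dp,
    pderiv_one_phase, pderiv_ofReal (differentiableAt_coord_self 0 x), pderiv_coord_self,
    pderiv_const]
  refine C2_ext ?_ ?_
  · simp
  · simp
    linear_combination (x 0 : ℂ) * phase x * Complex.I_mul_I

/-- With the next two lemmas: the parameters (s, v) are conformal, with factor 1 + s². -/
lemma metric_model_zero_zero (x : R2) : metric (model 1 0 0) x 0 0 = 1 + x 0 ^ 2 := by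
  rw [metric_apply, pderiv_zero_model, inner_coord]
  simp
  linear_combination phase_re_sq_add_im_sq x

lemma metric_model_zero_one (x : R2) : metric (model 1 0 0) x 0 1 = 0 := by
  rw [metric_apply, pderiv_zero_model, pderiv_one_model, inner_coord]
  simp
  ring

lemma metric_model_one_one (x : R2) : metric (model 1 0 0) x 1 1 = 1 + x 0 ^ 2 := by
  rw [metric_apply, pderiv_one_model, inner_coord]
  simp
  linear_combination x 0 ^ 2 * phase_re_sq_add_im_sq x

lemma det_metric_model (x : R2) : (metric (model 1 0 0) x).det = (1 + x 0 ^ 2) ^ 2 := by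
  rw [metric_det, metric_model_zero_zero, metric_model_zero_one, metric_model_one_one]
  ring

lemma areaDensity_model (x : R2) : areaDensity (model 1 0 0) x = 1 + x 0 ^ 2 := by
  rw [areaDensity, det_metric_model, Real.sqrt_sq (by positivity)]

lemma kaehler_model (x : R2) (i j : Fin 2) :
    kaehler (pderiv i (model 1 0 0) x) (pderiv j (model 1 0 0) x) = 0 := by
  have h01 : kaehler (pderiv 0 (model 1 0 0) x) (pderiv 1 (model 1 0 0) x) = 0 := by
    rw [pderiv_zero_model, pderiv_one_model, kaehler, inner_coord]
    simp
    linear_combination (-x 0) * phase_re_sq_add_im_sq x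
  fin_cases i <;> fin_cases j
  · exact kaehler_self _
  · exact h01
  · change kaehler (pderiv 1 _ x) (pderiv 0 _ x) = 0
    rw [kaehler_swap, h01, neg_zero]
  · exact kaehler_self _

lemma fderiv_model_injective (x : R2) : Function.Injective (fderiv ℝ (model 1 0 0) x) := by
  rw [injective_iff_map_eq_zero]
  intro y hy
  have hs : 1 + x 0 ^ 2 ≠ 0 := by positivity
  rw [fderiv_eq_pderiv] at hy
  have h0 := congrArg (fun v => (inner ℝ v (pderiv 0 (model 1 0 0) x) : ℝ)) hy
  have h1 := congrArg (fun v => (inner ℝ v (pderiv 1 (model 1 0 0) x) : ℝ)) hy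
  simp only [inner_add_left, real_inner_smul_left, inner_zero_left, ← metric_apply,
    metric_comm, metric_model_zero_zero, metric_model_zero_one, metric_model_one_one, mul_zero,
    add_zero, zero_add, mul_eq_zero, hs, or_false] at h0 h1
  ext i
  fin_cases i
  · exact h0
  · exact h1

/-- The metric being conformal, H is the normal part of (∂₀∂₀ + ∂₁∂₁)/(1 + s²) applied to the model.
This vector differs from (1, 0) by the tangent vector s/(1 + s²) ∂₀, so both have the same normal
part. -/
lemma meanCurvature_model (x : R2) :
    meanCurvature (model 1 0 0) x = normalPart (model 1 0 0) x !₂[1, 0] := by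
  have hs : (1 + x 0 ^ 2 : ℝ) ≠ 0 := by positivity
  have h1 : meanCurvature (model 1 0 0) x = normalPart (model 1 0 0) x
      ((1 + x 0 ^ 2 : ℝ)⁻¹ • ((!₂[1, 0] : C2) + !₂[0, -((x 0 : ℂ) * phase x)])) := by
    simp only [meanCurvature, secondFundamentalForm, Fin.sum_univ_two, metric_inv_zero_zero,
      metric_inv_zero_one, metric_inv_one_zero, metric_inv_one_one, metric_model_zero_zero,
      metric_model_zero_one, metric_model_one_one, det_metric_model, pderiv_zero_zero_model,
      pderiv_one_one_model]
    simp only [normalPart, map_smul, map_add, neg_zero, zero_div, zero_smul, add_zero, zero_add,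
      smul_add]
    congr 2
    all_goals field_simp
  have h2 : (!₂[1, 0] : C2) -
      (1 + x 0 ^ 2 : ℝ)⁻¹ • ((!₂[1, 0] : C2) + !₂[0, -((x 0 : ℂ) * phase x)]) =
      fderiv ℝ (model 1 0 0) x !₂[x 0 / (1 + x 0 ^ 2), 0] := by
    have hs' : (1 + (x 0 : ℂ) ^ 2) ≠ 0 := by exact_mod_cast hs
    rw [fderiv_eq_pderiv, pderiv_zero_model]
    refine C2_ext ?_ ?_
    · simp
      field_simp
      ring
    · simp
      field_simp
  have h3 : normalPart (model 1 0 0) x (fderiv ℝ (model 1 0 0) x !₂[x 0 / (1 + x 0 ^ 2), 0]) = 0 :=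
    normalPart_eq_of (by simp) (sub_zero _)
  rw [h1]
  rw [← h2, normalPart, map_sub, sub_eq_zero] at h3
  exact h3.symm

/-- The complex determinant of the frame is -i e^{-iv}(1 + s²); the factor -i accounts for the shift
by π/2. -/
lemma isLagrangianAngleOn_model : IsLagrangianAngleOn (model 1 0 0) Set.univ
    (fun x => -x 1 - Real.pi / 2) := by
  refine ⟨((contDiff_coord 1).neg.sub contDiff_const).contDiffOn, fun x _ => ?_⟩
  have h : Complex.exp (Complex.I * ((-x 1 - Real.pi / 2 : ℝ) : ℂ)) = -Complex.I * phase x := by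
    have h2 : Complex.exp (-((Real.pi / 2 : ℂ) * Complex.I)) = -Complex.I := by
      rw [Complex.exp_neg, Complex.exp_pi_div_two_mul_I, Complex.inv_I]
    rw [phase, ← h2, ← Complex.exp_add]
    congr 1
    push_cast
    ring
  rw [h, areaDensity_model, complexDet, pderiv_zero_model, pderiv_one_model]
  simp
  ring

lemma laplaceBeltrami_model (x : R2) :
    laplaceBeltrami (model 1 0 0) (fun x => -x 1 - Real.pi / 2) x = 0 := by
  have hβ : ∀ k y, pderiv k (fun x : R2 => -x 1 - Real.pi / 2) y = - if 1 = k then 1 else 0 := by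
    intro k y
    rw [pderiv_sub (differentiableAt_coord_self 1 y).fun_neg (differentiableAt_const _), pderiv_neg,
      pderiv_coord_self, pderiv_const, sub_zero]
  have h0 : (fun y => areaDensity (model 1 0 0) y * ∑ j, (metric (model 1 0 0) y)⁻¹ 0 j *
      pderiv j (fun x : R2 => -x 1 - Real.pi / 2) y) = fun _ => 0 := by
    ext1 y
    simp [hβ, metric_inv_zero_one, metric_model_zero_one]
  have h1 : (fun y => areaDensity (model 1 0 0) y * ∑ j, (metric (model 1 0 0) y)⁻¹ 1 j *
      pderiv j (fun x : R2 => -x 1 - Real.pi / 2) y) = fun _ => -1 := by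
    ext1 y
    have hs : (1 + y 0 ^ 2 : ℝ) ≠ 0 := by positivity
    simp only [Fin.sum_univ_two, hβ, metric_inv_one_one, metric_inv_one_zero,
      metric_model_zero_one, metric_model_zero_zero, det_metric_model, areaDensity_model]
    simp
    field_simp
  rw [laplaceBeltrami, Fin.sum_univ_two, h0, h1, pderiv_const, pderiv_const]
  simp

theorem isHSLTranslatingSoliton_model :
    IsHSLTranslatingSoliton (model 1 0 0) (!₂[1, 0] : C2) where
  immersion := by
    refine ⟨(contDiff_model 1 0 0).contMDiff, fun p => ?_⟩
    rw [mfderiv_eq_fderiv]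
    exact fderiv_model_injective p
  lagrangian := by
    intro c hc x _ i j
    rw [chartedSpaceSelf_atlas] at hc
    subst hc
    exact kaehler_model x i j
  hamiltonianStationary := by
    intro c hc x _
    rw [chartedSpaceSelf_atlas] at hc
    subst hc
    exact ⟨Set.univ, isOpen_univ, Set.mem_univ _, subset_rfl, _, isLagrangianAngleOn_model,
      fun y _ => laplaceBeltrami_model y⟩
  translating := by
    refine ⟨fun h => ?_, fun c hc x _ => ?_⟩
    · simpa using congrArg (fun p : C2 => p 0) h
    · rw [chartedSpaceSelf_atlas] at hc
      subst hc
      exact meanCurvature_model x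

theorem not_isTotallyGeodesic_model : ¬ IsTotallyGeodesic (model 1 0 0) := by
  intro h
  have h1 : secondFundamentalForm (model 1 0 0) 0 0 0 = 0 :=
    h (OpenPartialHomeomorph.refl R2) (chartedSpaceSelf_atlas.2 rfl) 0 (Set.mem_univ _) 0 0
  rw [secondFundamentalForm, pderiv_zero_zero_model] at h1
  -- At the origin the tangent plane is spanned by (0, 1) and (i, 0), so first coordinates of
  -- tangent vectors are purely imaginary, whereas ∂₀∂₀ of the model is (1, 0).
  obtain ⟨y, hy⟩ := sub_normalPart_mem (model 1 0 0) 0 !₂[1, 0]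
  rw [h1, sub_zero, fderiv_eq_pderiv, pderiv_zero_model, pderiv_one_model] at hy
  have h2 := congrArg (fun p : C2 => (p 0).re) hy
  simp at h2

end LagrangianSoliton

theorem corollary3 :
    (∀ (M : Type*) [TopologicalSpace M] [T2Space M] [SecondCountableTopology M]
        [ConnectedSpace M] [ChartedSpace LagrangianSoliton.R2 M] [IsManifold (𝓡 2) ∞ M]
        (φ : M → LagrangianSoliton.C2) (e : LagrangianSoliton.C2),
      LagrangianSoliton.IsHSLTranslatingSoliton φ e →
      ¬ LagrangianSoliton.IsTotallyGeodesic φ →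
      ∃ (r : ℝ) (U : LagrangianSoliton.C2 ≃ₗᵢ[ℂ] LagrangianSoliton.C2)
        (v : LagrangianSoliton.C2) (O : Set LagrangianSoliton.C2),
        0 < r ∧ IsOpen O ∧
          Set.range φ = O ∩ ((fun p => r • U p + v) '' LagrangianSoliton.surfaceM)) ∧
    (∃ Φ : LagrangianSoliton.R2 → LagrangianSoliton.C2,
      Topology.IsEmbedding Φ ∧
      Set.range Φ = LagrangianSoliton.surfaceM ∧
      LagrangianSoliton.IsHSLTranslatingSoliton Φ (!₂[1, 0] : LagrangianSoliton.C2) ∧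
      ¬ LagrangianSoliton.IsTotallyGeodesic Φ) := by
  refine ⟨fun M _ _ _ _ _ _ φ e hφ hg => hφ.range_eq hg, LagrangianSoliton.model 1 0 0,
    LagrangianSoliton.isEmbedding_model one_ne_zero 0 0,
    LagrangianSoliton.range_model_eq_surfaceM, LagrangianSoliton.isHSLTranslatingSoliton_model,
    LagrangianSoliton.not_isTotallyGeodesic_model⟩
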